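/- Let $k$ be a field, $R=k[x_0,x_1]$ with its standard grading, and $\mathfrak m=(x_0,x_1)$. Let $I\subset R$ be an ideal of height two generated by $n$ forms $f_1,\dots,f_n$ of the same degree $d$, with a graded free resolution $$0\to\bigoplus_{j=1}^{n-1}R(-d_j)\xrightarrow{\ \varphi\ }R^n\xrightarrow{(f_1,\dots,f_n)}I(d)\to0,\qquad 1\le d_1\le\cdots\le d_{n-1}.$$ Fix $1\le m\le n-1$, let $\varphi_m$ be the matrix formed by the first $m$ columns of $\varphi$, and put $$E=\operatorname{coker}\varphi_m,\qquad F=E^{**}=\operatorname{Hom}_R(\operatorname{Hom}_R(E,R),R),\qquad M=F_{\ge0},$$ where $E$ is graded as a quotient of $R^n$ (basis vectors in degree $0$) and $F$ carries the induced grading. For a graded $R$-module $N$ let $\mathcal R(N)$ be its Rees algebra, the quotient of $\operatorname{Sym}_R(N)$ by its $R$-torsion, bigraded so that a form $p\in R$ of degree $a$ has bidegree $(a,0)$ and an element of $N$ of degree $b$ has bidegree $(b,1)$; let $\mathcal R(N)_{\ge c,*}$ denote the sum of its components of bidegree $(i,j)$ with $i\ge c$. Then the canonical maps $E\to M\to F$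 and $\mathcal R(E)\to\mathcal R(M)\to\mathcal R(F)$ are injective and these Rees algebras are domains. Regard the canonical maps as inclusions. The following hold. (a) $\mathcal R(E)_{\ge d_m-1,*}=\mathcal R(M)_{\ge d_m-1,*}=\mathcal R(F)_{\ge d_m-1,*}$. (b) $\mathcal R(M)$ is the integral closure of $\mathcal R(E)$ in the field of fractions of $\mathcal R(E)$. (c) $E$ is a reduction of $M$ in $F$; that is, $E\subseteq M$, and there is $r\ge0$ with $M^{r+1}=E\,M^{r}$, the products of $R$-submodules being taken in $\mathcal R(F)$. -/

import Mathlib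

noncomputable section

/-! ### Rees algebras of modules -/

section Rees

variable (R : Type*) [CommRing R] (N : Type*) [AddCommGroup N] [Module R N]

/-- The ideal of `R`-torsion elements of the symmetric algebra of `N`. -/
def symTorsion : Ideal (SymmetricAlgebra R N) where
  carrier := {a | ∃ r ∈ nonZeroDivisors R, r • a = 0}
  zero_mem' := ⟨1, one_mem _, by simp⟩
  add_mem' := by
    rintro a b ⟨r, hr, ha⟩ ⟨s, hs, hb⟩
    refine ⟨r * s, mul_mem hr hs, ?_⟩
    rw [smul_add, mul_smul, mul_smul, hb, smul_zero, add_zero, smul_comm, ha, smul_zero]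
  smul_mem' := by
    rintro c a ⟨r, hr, ha⟩
    exact ⟨r, hr, by rw [smul_eq_mul, ← mul_smul_comm, ha, mul_zero]⟩

/-- The Rees algebra of the module `N`: the symmetric algebra of `N` modulo its `R`-torsion. -/
abbrev Rees : Type _ := SymmetricAlgebra R N ⧸ symTorsion R N

/-- The canonical `R`-linear map from `N` to its Rees algebra. -/
def reesι : N →ₗ[R] Rees R N :=
  (Ideal.Quotient.mkₐ R (symTorsion R N)).toLinearMap ∘ₗ SymmetricAlgebra.ι R N

variable {R N} {P : Type*} [AddCommGroup P] [Module R P]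

/-- The homomorphism of Rees algebras induced by a linear map. -/
def reesMap (f : N →ₗ[R] P) : Rees R N →ₐ[R] Rees R P :=
  Ideal.Quotient.liftₐ (symTorsion R N)
    ((Ideal.Quotient.mkₐ R (symTorsion R P)).comp
      (SymmetricAlgebra.lift (SymmetricAlgebra.ι R P ∘ₗ f)))
    (by
      rintro a ⟨r, hr, ha⟩
      rw [AlgHom.comp_apply, Ideal.Quotient.mkₐ_eq_mk, Ideal.Quotient.eq_zero_iff_mem]
      exact ⟨r, hr, by rw [← map_smul, ha, map_zero]⟩)

/-- `U` is a reduction of `L` in `N`: one has `U ⊆ L ⊆ N`, and `L ^ (r + 1) = U * L ^ r` for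
some `r`, the products being taken in the Rees algebra of `N`. -/
def IsReductionIn (U L : Submodule R N) : Prop :=
  U ≤ L ∧ ∃ r : ℕ,
    (L.map (reesι R N)) ^ (r + 1) = U.map (reesι R N) * (L.map (reesι R N)) ^ r

end Rees

/-! ### Gradings over the polynomial ring in two variables -/

section Graded

variable (k : Type*) [Field k]

/-- The polynomial ring `k[x₀, x₁]`. -/
abbrev Poly2 : Type _ := MvPolynomial (Fin 2) k

/-- The homogeneous component of degree `i ∈ ℤ` of `k[x₀, x₁]` (it is zero if `i < 0`). -/
def polyDeg (i : ℤ) : AddSubgroup (Poly2 k) :=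
  (MvPolynomial.weightedHomogeneousSubmodule k (fun _ : Fin 2 => (1 : ℤ)) i).toAddSubgroup

variable {k} {N : Type*} [AddCommGroup N] [Module (Poly2 k) N]

/-- The grading of the dual of a graded module: a functional has degree `j` if it raises degrees
by `j`. -/
def dualDeg (deg : ℤ → AddSubgroup N) (j : ℤ) : AddSubgroup (Module.Dual (Poly2 k) N) where
  carrier := {ψ | ∀ i : ℤ, ∀ x ∈ deg i, ψ x ∈ polyDeg k (i + j)}
  zero_mem' := fun _ _ _ => zero_mem _
  add_mem' := fun ha hb i x hx => add_mem (ha i x hx) (hb i x hx)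
  neg_mem' := fun ha i x hx => neg_mem (ha i x hx)

/-- The truncation of a graded module in degrees `≥ c`. -/
def truncGE (deg : ℤ → AddSubgroup N) (c : ℤ) : Submodule (Poly2 k) N :=
  Submodule.span (Poly2 k) {x | ∃ i : ℤ, c ≤ i ∧ x ∈ deg i}

/-- The grading induced on a submodule. -/
def subDeg (deg : ℤ → AddSubgroup N) (L : Submodule (Poly2 k) N) (i : ℤ) : AddSubgroup L :=
  (deg i).comap L.subtype.toAddMonoidHom

/-- The component of bidegree `(i, j)` of the Rees algebra of a graded module: it is generated
additively by the products `p * y₁ ⋯ y_j` of a form `p ∈ k[x₀, x₁]` of degree `a` and `j`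
homogeneous elements of the module, of degrees `b₁, …, b_j` with `a + b₁ + ⋯ + b_j = i`. -/
def reesDeg (deg : ℤ → AddSubgroup N) (i : ℤ) (j : ℕ) : AddSubgroup (Rees (Poly2 k) N) :=
  AddSubgroup.closure {z | ∃ (a : ℤ) (p : Poly2 k) (b : Fin j → ℤ) (y : Fin j → N),
    p ∈ polyDeg k a ∧ (∀ l, y l ∈ deg (b l)) ∧ a + ∑ l, b l = i ∧
      z = p • ∏ l, reesι (Poly2 k) N (y l)}

/-- The part of `x`-degree `≥ c` of the Rees algebra of a graded module. -/
def reesGE (deg : ℤ → AddSubgroup N) (c : ℤ) : AddSubgroup (Rees (Poly2 k) N) :=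
  ⨆ (i : ℤ) (_ : c ≤ i) (j : ℕ), reesDeg deg i j

end Graded

/-! ### The cokernel of a matrix, its bidual, and the nonnegative part of the bidual -/

section Coker

variable {k : Type*} [Field k] {n m : ℕ} (A : Matrix (Fin n) (Fin m) (Poly2 k))

/-- The module `E`, the cokernel of the matrix `A`. -/
abbrev ModE : Type _ := (Fin n → Poly2 k) ⧸ LinearMap.range A.mulVecLin

/-- The grading of `E` for which the basis vectors of `R ^ n` have degree zero. -/
def degE (i : ℤ) : AddSubgroup (ModE A) :=
  (AddSubgroup.pi Set.univ fun _ : Fin n => polyDeg k i).map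
    (Submodule.mkQ (LinearMap.range A.mulVecLin)).toAddMonoidHom

/-- The module `F = E**`. -/
abbrev ModF : Type _ := Module.Dual (Poly2 k) (Module.Dual (Poly2 k) (ModE A))

/-- The grading of `F = E**`. -/
def degF : ℤ → AddSubgroup (ModF A) := dualDeg (dualDeg (degE A))

/-- The submodule `M = F_{≥ 0}` of `F`. -/
def subM : Submodule (Poly2 k) (ModF A) := truncGE (degF A) 0

/-- The grading of `M`. -/
def degM : ℤ → AddSubgroup (subM A) := subDeg (degF A) (subM A)

/-- The canonical map `E → E** = F`. -/
def toF : ModE A →ₗ[Poly2 k] ModF A := Module.Dual.eval (Poly2 k) (ModE A)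

theorem toF_mem_degF {i : ℤ} {e : ModE A} (he : e ∈ degE A i) : toF A e ∈ degF A i := by
  intro j ψ hψ
  have h := hψ i e he
  rw [add_comm] at h
  exact h

theorem toF_mem_subM (e : ModE A) : toF A e ∈ subM A := by
  obtain ⟨v, rfl⟩ := Submodule.mkQ_surjective _ e
  rw [pi_eq_sum_univ' v, map_sum, map_sum]
  refine sum_mem fun l _ => ?_
  rw [map_smul, map_smul]
  refine Submodule.smul_mem _ _ (Submodule.subset_span ⟨0, le_rfl, toF_mem_degF A ?_⟩)
  refine ⟨_, ?_, rfl⟩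
  rintro t -
  change MvPolynomial.IsWeightedHomogeneous _ _ _
  by_cases h : t = l
  · simpa [h] using MvPolynomial.isWeightedHomogeneous_one k (fun _ : Fin 2 => (1 : ℤ))
  · simpa [h, eq_comm] using
      MvPolynomial.isWeightedHomogeneous_zero k (fun _ : Fin 2 => (1 : ℤ)) 0

/-- The canonical map `E → M`. -/
def toM : ModE A →ₗ[Poly2 k] subM A := (toF A).codRestrict (subM A) (toF_mem_subM A)

/-- The inclusion `M → F`. -/
def inclM : subM A →ₗ[Poly2 k] ModF A := (subM A).subtype

/-- The map `R(E) → R(F)` induced by `E → F`. -/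
def reesEF : Rees (Poly2 k) (ModE A) →ₐ[Poly2 k] Rees (Poly2 k) (ModF A) := reesMap (toF A)

/-- The map `R(E) → R(M)` induced by `E → M`. -/
def reesEM : Rees (Poly2 k) (ModE A) →ₐ[Poly2 k] Rees (Poly2 k) (subM A) := reesMap (toM A)

/-- The map `R(M) → R(F)` induced by `M → F`. -/
def reesMF : Rees (Poly2 k) (subM A) →ₐ[Poly2 k] Rees (Poly2 k) (ModF A) := reesMap (inclM A)

end Coker

end

/-!
Write `R = k[x₀, x₁]`. The module `F = E**` is free: `E*` is the module of relations among the rows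
of a matrix of forms, a graded submodule of `R ^ n` that is saturated with respect to `x₀`, and over
a polynomial ring in two variables such a submodule has a homogeneous basis
(`exists_homogeneous_basis`). Its degrees are nonnegative, so `F` has a basis `e₁, …, e_s` with
`e_t` of degree `-a_t ≤ 0`, and `R(F)` is the polynomial ring `R[e₁, …, e_s]`
(`reesEquivMvPolynomial`).

If `r` lies in the ideal generated by the `f_i`, then multiplication by `r` on `E` factors through a
free module (`exists_free_factorization`), so `r F ⊆ E` (`exists_bidual_section`). As the ideal has
height two, this holds for powers of both variables. This yields the injectivity of the maps of Rees
algebras, and it reduces the comparison of `E` and `F` to the fact that a form of degree at least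
`2 N - 1` is in `(x₀ ^ N, x₁ ^ N)`: `E` and `F` agree in degrees at least `c = d_m - 1`
(`exists_isHomVec_toF_eq`).

(a) A form of degree `i + a` with `i, a ≥ 0` is a sum of products of forms of degrees `i` and `a`.
Hence the component of bidegree `(i, j)` of `R(F)` is `R_i F_0 ^ j` if `i ≥ 0`
(`bidegPart_degF_le`), and `M` is generated by `F_0`. If moreover `i ≥ c`, then
`R_i F_0 ⊆ F_i = E_i = R_i E_0`, so one factor after the other can be moved from `F_0` to `E_0`
(`bidegPart_degF_le_degE`).

(c) For `y ∈ M` one has `R_c y ⊆ R_c E`, because `M` is generated by `F_0`. So multiplication by `y`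
acts on the monomials of degree `c` by a square matrix with entries in `E`
(`exists_matrix_of_mem_subM`), and the determinant trick gives `y ^ (c + 1) ∈ E M ^ c`
(`pow_card_mem_of_mulVec_eq`). As `M` is finitely generated, `E` is a reduction of `M`
(`exists_pow_succ_eq_mul_pow`).

(b) The same matrices show that `R(M)` is integral over `R(E)`. Conversely, an element of the field
of fractions that is integral over `R(E)` is in the factorial ring `R(F)`. It is integral over the
subring of the elements of nonnegative degree, which is integrally closed in `R(F)`: the
multiplication of the elements of degree `i` with `T ^ i` embeds `R(F)` in its Laurent polynomials
in `T`, in which the polynomials in `T` are integrally closed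
(`mem_nonnegSubring_of_isIntegralElem`). The elements of nonnegative degree form `R(M)`,
because those of bidegree `(i, j)` with `i ≥ 0` are in `R_i F_0 ^ j` (`nonnegSubring_le`).
-/

section

open MvPolynomial

/-! ### Forms in two variables -/

section PolynomialGrading

variable {k : Type*} [Field k]

theorem mem_polyDeg_iff {i : ℤ} {p : Poly2 k} :
    p ∈ polyDeg k i ↔ IsWeightedHomogeneous (fun _ : Fin 2 => (1 : ℤ)) p i := Iff.rfl

theorem weight_one_int (d : Fin 2 →₀ ℕ) :
    Finsupp.weight (fun _ : Fin 2 => (1 : ℤ)) d = (d.degree : ℤ) := by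
  simp [Finsupp.weight_apply, Finsupp.degree_apply, Finsupp.sum]

theorem mem_polyDeg_natCast_iff {i : ℕ} {p : Poly2 k} :
    p ∈ polyDeg k i ↔ p.IsHomogeneous i := by
  rw [mem_polyDeg_iff]
  have h1 : ∀ d : Fin 2 →₀ ℕ, Finsupp.weight (1 : Fin 2 → ℕ) d = d.degree := by
    intro d
    simp [Finsupp.weight_apply, Finsupp.degree_apply, Finsupp.sum]
  constructor
  · intro h d hd
    have := h hd
    rw [weight_one_int] at this
    rw [h1]
    exact_mod_cast this
  · intro h d hd
    have := h hd
    rw [h1] at this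
    rw [weight_one_int]
    exact_mod_cast this

theorem eq_zero_of_mem_polyDeg_neg {i : ℤ} (hi : i < 0) {p : Poly2 k} (hp : p ∈ polyDeg k i) :
    p = 0 := by
  ext d
  by_contra hd
  have := hp hd
  rw [weight_one_int] at this
  omega

theorem C_mem_polyDeg (a : k) : (C a : Poly2 k) ∈ polyDeg k 0 :=
  isWeightedHomogeneous_C _ a

theorem X_mem_polyDeg (t : Fin 2) : (X t : Poly2 k) ∈ polyDeg k 1 :=
  isWeightedHomogeneous_X k _ t

theorem mul_mem_polyDeg {i j : ℤ} {p q : Poly2 k} (hp : p ∈ polyDeg k i) (hq : q ∈ polyDeg k j) :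
    p * q ∈ polyDeg k (i + j) :=
  IsWeightedHomogeneous.mul hp hq

theorem X_pow_mem_polyDeg (t : Fin 2) (N : ℕ) : (X t ^ N : Poly2 k) ∈ polyDeg k N := by
  rw [mem_polyDeg_natCast_iff]
  exact isHomogeneous_X_pow t N

theorem C_mul_mem_polyDeg {i : ℤ} {p : Poly2 k} (a : k) (hp : p ∈ polyDeg k i) :
    C a * p ∈ polyDeg k i := by
  simpa using mul_mem_polyDeg (C_mem_polyDeg a) hp

/-- The homogeneous component of degree `i ∈ ℤ`. -/
noncomputable def polyComp (i : ℤ) : Poly2 k →ₗ[k] Poly2 k :=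
  weightedHomogeneousComponent (fun _ : Fin 2 => (1 : ℤ)) i

theorem polyComp_mem (i : ℤ) (p : Poly2 k) : polyComp i p ∈ polyDeg k i :=
  weightedHomogeneousComponent_isWeightedHomogeneous i p

theorem polyComp_of_mem {i : ℤ} {p : Poly2 k} (hp : p ∈ polyDeg k i) : polyComp i p = p :=
  weightedHomogeneousComponent_eq_self hp

theorem polyComp_of_mem_ne {i j : ℤ} (hij : i ≠ j) {p : Poly2 k} (hp : p ∈ polyDeg k i) :
    polyComp j p = 0 :=
  IsWeightedHomogeneous.weightedHomogeneousComponent_ne _ hp hij.symm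

theorem exists_sum_polyComp (p : Poly2 k) (s : Finset ℤ) :
    ∃ t : Finset ℤ, s ⊆ t ∧ p = ∑ i ∈ t, polyComp i p := by
  classical
  have hfin := weightedHomogeneousComponent_finsupp (w := fun _ : Fin 2 => (1 : ℤ)) p
  refine ⟨s ∪ hfin.toFinset, Finset.subset_union_left, ?_⟩
  conv_lhs => rw [← sum_weightedHomogeneousComponent (fun _ : Fin 2 => (1 : ℤ)) p]
  refine finsum_eq_sum_of_support_subset _ ?_
  intro i hi
  rw [Finset.coe_union]
  exact Or.inr (hfin.mem_toFinset.2 hi)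

theorem polyComp_mul_of_mem {i a : ℤ} (p : Poly2 k) {q : Poly2 k} (hq : q ∈ polyDeg k a) :
    polyComp i (p * q) = polyComp (i - a) p * q := by
  obtain ⟨t, ht, hp⟩ := exists_sum_polyComp p {i - a}
  conv_lhs => rw [hp]
  rw [Finset.sum_mul, map_sum, Finset.sum_eq_single_of_mem (i - a) (ht (by simp))]
  · rw [polyComp_of_mem]
    simpa using mul_mem_polyDeg (polyComp_mem (i - a) p) hq
  · intro j _ hj
    exact polyComp_of_mem_ne (by omega) (mul_mem_polyDeg (polyComp_mem j p) hq)

theorem polyComp_mul_of_mem' {i a : ℤ} {p : Poly2 k} (q : Poly2 k) (hp : p ∈ polyDeg k a) :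
    polyComp i (p * q) = p * polyComp (i - a) q := by
  rw [mul_comm, polyComp_mul_of_mem q hp, mul_comm]

/-- A form of degree `i` in two variables is a multiple of `X 1 ^ i` modulo `X 0`. -/
theorem exists_eq_C_mul_add_X_mul {i : ℤ} {p : Poly2 k} (hp : p ∈ polyDeg k i) :
    ∃ (a : k) (q : Poly2 k), q ∈ polyDeg k (i - 1) ∧ p = C a * X 1 ^ i.toNat + X 0 * q := by
  let good : Poly2 k → Prop := fun p =>
    ∃ (a : k) (q : Poly2 k), q ∈ polyDeg k (i - 1) ∧ p = C a * X 1 ^ i.toNat + X 0 * q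
  have hmon : ∀ d : Fin 2 →₀ ℕ, (d.degree : ℤ) = i → ∀ r, good (monomial d r) := by
    intro d hd r
    have hd' : d 0 + d 1 = i.toNat := by
      have : d.degree = d 0 + d 1 := by simp [Finsupp.degree_eq_sum]
      omega
    have hm : (monomial d r : Poly2 k) = C r * (X 0 ^ d 0 * X 1 ^ d 1) := by
      rw [monomial_eq, Finsupp.prod_fintype _ _ (by simp), Fin.prod_univ_two]
    rcases Nat.eq_zero_or_pos (d 0) with h0 | h0
    · refine ⟨r, 0, zero_mem _, ?_⟩
      rw [hm, h0, ← hd', h0]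
      simp
    · refine ⟨0, C r * (X 0 ^ (d 0 - 1) * X 1 ^ d 1), ?_, ?_⟩
      · have := C_mul_mem_polyDeg r (mul_mem_polyDeg (X_pow_mem_polyDeg (k := k) 0 (d 0 - 1))
          (X_pow_mem_polyDeg 1 (d 1)))
        have hi : (((d 0 - 1 : ℕ) : ℤ) + (d 1 : ℕ)) = i - 1 := by
          have := d.degree_eq_sum
          rw [Fin.sum_univ_two] at this
          omega
        rwa [hi] at this
      · obtain ⟨e, he⟩ : ∃ e, d 0 = e + 1 := ⟨d 0 - 1, by omega⟩
        rw [hm, he]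
        simp only [Nat.add_sub_cancel, map_zero, zero_mul, zero_add]
        ring
  have hadd : ∀ p q, good p → good q → good (p + q) := by
    rintro _ _ ⟨a, q, hq, rfl⟩ ⟨b, r, hr, rfl⟩
    exact ⟨a + b, q + r, add_mem hq hr, by rw [map_add]; ring⟩
  have h0 : good 0 := ⟨0, 0, zero_mem _, by simp⟩
  change good p
  rw [p.as_sum]
  refine Finset.sum_induction _ good hadd h0 fun d hd => hmon d ?_ _
  rw [← weight_one_int]
  exact hp (mem_support_iff.1 hd)

/-- A form of degree `c` is a combination of the monomials `X 0 ^ j * X 1 ^ (c - j)`. -/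
theorem exists_eq_sum_monomials {c : ℕ} {p : Poly2 k} (hp : p ∈ polyDeg k c) :
    ∃ a : Fin (c + 1) → k, p = ∑ j, C (a j) * (X 0 ^ (j : ℕ) * X 1 ^ (c - j)) := by
  induction c generalizing p with
  | zero =>
    obtain ⟨a, q, hq, rfl⟩ := exists_eq_C_mul_add_X_mul hp
    rw [eq_zero_of_mem_polyDeg_neg (by simp) hq]
    exact ⟨fun _ => a, by simp⟩
  | succ c ih =>
    obtain ⟨a, q, hq, rfl⟩ := exists_eq_C_mul_add_X_mul hp
    have hc : ((c + 1 : ℕ) : ℤ) - 1 = c := by push_cast; ring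
    rw [hc] at hq
    obtain ⟨b, rfl⟩ := ih hq
    refine ⟨Fin.cons a b, ?_⟩
    rw [Finset.mul_sum, Fin.sum_univ_succ (n := c + 1)]
    simp only [Int.toNat_natCast, Fin.cons_zero, Fin.val_zero, pow_zero, one_mul, Nat.sub_zero,
      Fin.cons_succ, Fin.val_succ, Nat.add_sub_add_right]
    congr 1
    refine Finset.sum_congr rfl fun j _ => ?_
    ring

theorem monomial_mem_polyDeg {c : ℕ} (j : Fin (c + 1)) :
    (X 0 ^ (j : ℕ) * X 1 ^ (c - j) : Poly2 k) ∈ polyDeg k c := by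
  have := mul_mem_polyDeg (X_pow_mem_polyDeg (k := k) 0 j) (X_pow_mem_polyDeg 1 (c - j))
  have hj : ((j : ℕ) : ℤ) + ((c - j : ℕ) : ℤ) = c := by omega
  rwa [hj] at this

/-- Forms of degree at least `2 N - 1` lie in the ideal generated by `X 0 ^ N` and `X 1 ^ N`. -/
theorem exists_eq_X_pow_combination {N : ℕ} {i : ℤ} (hi : 2 * N - 1 ≤ i) {p : Poly2 k}
    (hp : p ∈ polyDeg k i) : ∃ q r : Poly2 k, p = X 1 ^ N * q - X 0 ^ N * r := by
  rcases lt_or_ge i 0 with h0 | h0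
  · exact ⟨0, 0, by rw [eq_zero_of_mem_polyDeg_neg h0 hp]; simp⟩
  lift i to ℕ using h0
  obtain ⟨a, rfl⟩ := exists_eq_sum_monomials hp
  refine Finset.sum_induction _ (fun p : Poly2 k => ∃ q r : Poly2 k, p = X 1 ^ N * q - X 0 ^ N * r)
    ?_ ⟨0, 0, by simp⟩ fun j _ => ?_
  · rintro _ _ ⟨q, r, rfl⟩ ⟨q', r', rfl⟩
    exact ⟨q + q', r + r', by ring⟩
  · rcases le_or_gt N j with h | h
    · obtain ⟨e, he⟩ := Nat.exists_eq_add_of_le h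
      exact ⟨0, -(C (a j) * (X 0 ^ e * X 1 ^ (i - j))), by rw [he, pow_add]; ring⟩
    · obtain ⟨e, he⟩ := Nat.exists_eq_add_of_le (show N ≤ i - j by omega)
      exact ⟨C (a j) * (X 0 ^ (j : ℕ) * X 1 ^ e), 0, by rw [he, pow_add]; ring⟩

theorem prime_X (t : Fin 2) : Prime (X t : Poly2 k) := MvPolynomial.X_prime

theorem X_zero_pow_dvd_of_mul {N : ℕ} {p q : Poly2 k} (h : X 1 ^ N * p = X 0 ^ N * q) :
    ∃ r, p = X 0 ^ N * r ∧ q = X 1 ^ N * r := by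
  have hco : ¬ (X 0 : Poly2 k) ∣ X 1 ^ N := by
    intro hd
    have := (prime_X 0).dvd_of_dvd_pow hd
    rw [MvPolynomial.X_dvd_X] at this
    simp at this
  have hd : (X 0 : Poly2 k) ^ N ∣ p :=
    (prime_X 0).pow_dvd_of_dvd_mul_left N hco (Dvd.intro _ h.symm)
  obtain ⟨r, rfl⟩ := hd
  refine ⟨r, rfl, ?_⟩
  have h0 : (X 0 : Poly2 k) ^ N ≠ 0 := pow_ne_zero _ (X_ne_zero 0)
  apply mul_left_cancel₀ h0
  rw [← h]
  ring

/-- A homogeneous ideal of height two of `k[x₀, x₁]` contains powers of both variables: the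
homogeneous core of a prime over it is a prime of height two inside `(x₀, x₁)`. -/
theorem X_mem_radical_span_of_height_eq_two {S : Set (Poly2 k)}
    (hS : ∀ p ∈ S, ∃ i : ℕ, p.IsHomogeneous i) (hht : (Ideal.span S).height = 2) (t : Fin 2) :
    X t ∈ (Ideal.span S).radical := by
  let _ : GradedAlgebra (homogeneousSubmodule (Fin 2) k) := MvPolynomial.gradedAlgebra
  have hI : (Ideal.span S).IsHomogeneous (homogeneousSubmodule (Fin 2) k) :=
    Ideal.homogeneous_span _ _ fun p hp => hS p hp
  rw [Ideal.radical_eq_sInf, Ideal.mem_sInf]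
  rintro p ⟨hIp, hp⟩
  let q := (Ideal.homogeneousCore (homogeneousSubmodule (Fin 2) k) p).toIdeal
  have hq : q.IsPrime := hp.homogeneousCore
  have hIq : Ideal.span S ≤ q := by
    have := Ideal.homogeneousCore_mono (homogeneousSubmodule (Fin 2) k) hIp
    rw [← hI.toIdeal_homogeneousCore_eq_self]
    exact this
  let m : Ideal (Poly2 k) := RingHom.ker (constantCoeff (σ := Fin 2) (R := k))
  have hm : m.IsPrime := RingHom.ker_isPrime _
  have hqm : q ≤ m := by
    intro x hx
    by_contra hx0
    have h0 := MvPolynomial.homogeneousComponent_mem_of_mem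
      (Ideal.homogeneousCore (homogeneousSubmodule (Fin 2) k) p).isHomogeneous hx 0
    rw [homogeneousComponent_zero] at h0
    exact hq.ne_top (Ideal.eq_top_of_isUnit_mem _ h0
      ((isUnit_iff_ne_zero.2 hx0).map (C : k →+* Poly2 k)))
  have hqm' : q = m := by
    by_contra hne
    have hlt : q < m := lt_of_le_of_ne hqm hne
    have h1 : (Ideal.span S).height ≤ q.height := Ideal.height_mono hIq
    have h2 := Ideal.height_strict_mono_of_isPrime_of_isPrime hlt
    have h3 := Ideal.height_le_ringKrullDim_of_ne_top hm.ne_top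
    rw [MvPolynomial.ringKrullDim_of_isNoetherianRing, ringKrullDim_eq_zero_of_field, zero_add,
      Nat.card_fin] at h3
    rw [hht] at h1
    have h4 : m.height ≤ 2 := WithBot.coe_le_coe.1 h3
    exact absurd (h1.trans_lt h2) (not_lt.2 h4)
  exact Ideal.toIdeal_homogeneousCore_le _ p (hqm' ▸ (by simp [m] : X t ∈ m) : X t ∈ q)

end PolynomialGrading

/-! ### Saturated graded submodules of free modules over `k[x₀, x₁]` are free -/

section HomogeneousBasis

variable {k : Type*} [Field k] {n : ℕ}

/-- A vector of forms of degree `i`. -/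
def IsHomVec (i : ℤ) (v : Fin n → Poly2 k) : Prop := ∀ l, v l ∈ polyDeg k i

/-- The homogeneous component of degree `i` of a vector. -/
noncomputable def vecComp (i : ℤ) : (Fin n → Poly2 k) →ₗ[k] (Fin n → Poly2 k) :=
  (polyComp i).compLeft (Fin n)

@[simp] theorem vecComp_apply (i : ℤ) (v : Fin n → Poly2 k) (l : Fin n) :
    vecComp i v l = polyComp i (v l) := rfl

theorem isHomVec_vecComp (i : ℤ) (v : Fin n → Poly2 k) : IsHomVec i (vecComp i v) :=
  fun _ => polyComp_mem _ _

theorem vecComp_smul_of_mem {i a : ℤ} (p : Poly2 k) {v : Fin n → Poly2 k} (hv : IsHomVec a v) :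
    vecComp i (p • v) = polyComp (i - a) p • v := by
  ext1 l
  exact polyComp_mul_of_mem p (hv l)

theorem vecComp_of_isHomVec {i : ℤ} {v : Fin n → Poly2 k} (hv : IsHomVec i v) :
    vecComp i v = v :=
  funext fun l => polyComp_of_mem (hv l)

theorem exists_sum_vecComp (v : Fin n → Poly2 k) :
    ∃ t : Finset ℤ, v = ∑ i ∈ t, vecComp i v := by
  classical
  choose t ht using fun l => exists_sum_polyComp (v l) ∅
  refine ⟨Finset.univ.biUnion t, funext fun l => ?_⟩
  rw [Finset.sum_apply]
  have hsub : t l ⊆ Finset.univ.biUnion t := Finset.subset_biUnion_of_mem t (Finset.mem_univ l)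
  simp only [vecComp_apply]
  rw [← Finset.sum_subset hsub]
  · exact (ht l).2
  · intro i _ hi
    rw [(ht l).2, map_sum]
    exact Finset.sum_eq_zero fun j hj =>
      polyComp_of_mem_ne (by rintro rfl; exact hi hj) (polyComp_mem j _)

theorem IsHomVec.of_X_smul {i : ℤ} {t : Fin 2} {v : Fin n → Poly2 k}
    (h : IsHomVec (i + 1) ((X t : Poly2 k) • v)) : IsHomVec i v := by
  intro l
  have h1 := polyComp_of_mem (h l)
  rw [Pi.smul_apply, smul_eq_mul, polyComp_mul_of_mem' _ (X_mem_polyDeg t),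
    add_sub_cancel_right] at h1
  rw [← mul_left_cancel₀ (X_ne_zero t) h1]
  exact polyComp_mem _ _

/-- A family of homogeneous vectors, of natural degrees `a`, that generates `K`. -/
def IsHomGenerating (K : Submodule (Poly2 k) (Fin n → Poly2 k)) {s : ℕ} (a : Fin s → ℕ)
    (e : Fin s → Fin n → Poly2 k) : Prop :=
  (∀ t, IsHomVec (a t) (e t)) ∧ Submodule.span (Poly2 k) (Set.range e) = K

theorem exists_isHomGenerating {K : Submodule (Poly2 k) (Fin n → Poly2 k)}
    (hgr : ∀ v ∈ K, ∀ i, vecComp i v ∈ K) :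
    ∃ (s : ℕ) (a : Fin s → ℕ) (e : Fin s → Fin n → Poly2 k), IsHomGenerating K a e := by
  let H : Set (Fin n → Poly2 k) := {v | v ∈ K ∧ ∃ a : ℕ, IsHomVec a v}
  have hH : Submodule.span (Poly2 k) H = K := by
    refine le_antisymm (Submodule.span_le.2 fun v hv => hv.1) fun v hv => ?_
    obtain ⟨t, ht⟩ := exists_sum_vecComp v
    rw [ht]
    refine sum_mem fun i _ => ?_
    rcases lt_or_ge i 0 with hi | hi
    · have : vecComp i v = 0 := funext fun l => eq_zero_of_mem_polyDeg_neg hi (polyComp_mem i _)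
      rw [this]
      exact zero_mem _
    · lift i to ℕ using hi
      exact Submodule.subset_span ⟨hgr v hv i, i, isHomVec_vecComp _ _⟩
  have hfg : (Submodule.span (Poly2 k) H).FG := IsNoetherian.noetherian _
  obtain ⟨T, hTH, hT⟩ := Submodule.fg_span_iff_fg_span_finset_subset H |>.1 hfg
  choose a ha using fun x : T => (hTH x.2).2
  refine ⟨T.card, fun t => a (T.equivFin.symm t), fun t => T.equivFin.symm t,
    fun t => ha _, ?_⟩
  rw [← hH, hT]
  congr 1
  ext v
  constructor
  · rintro ⟨t, rfl⟩
    exact (T.equivFin.symm t).2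
  · intro hv
    exact ⟨T.equivFin ⟨v, hv⟩, by simp⟩

/-- A homogeneous relation among homogeneous generators of a saturated graded submodule, in which
the number of generators is minimal, is trivial. Modulo `X 0` a relation of least degree has
coefficients `c_t X 1 ^ _`; dividing by a power of `X 1` and using saturation, a generator of
largest degree with `c_t ≠ 0` is a combination of the other ones. -/
theorem IsHomGenerating.relation_eq_zero {K : Submodule (Poly2 k) (Fin n → Poly2 k)}
    (hsat : ∀ v, (X 0 : Poly2 k) • v ∈ K → v ∈ K) {s : ℕ} {a : Fin s → ℕ}
    {e : Fin s → Fin n → Poly2 k} (he : IsHomGenerating K a e)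
    (hmin : ∀ s' < s, ∀ (a' : Fin s' → ℕ) (e' : Fin s' → Fin n → Poly2 k),
      ¬ IsHomGenerating K a' e')
    (N : ℕ) (p : Fin s → Poly2 k) (hp : ∀ t, p t ∈ polyDeg k (N - 1 - a t))
    (hrel : ∑ t, p t • e t = 0) : p = 0 := by
  classical
  induction N generalizing p with
  | zero =>
    exact funext fun t => eq_zero_of_mem_polyDeg_neg (by push_cast; omega) (hp t)
  | succ N ih =>
    have hp' : ∀ t, p t ∈ polyDeg k (N - a t) := fun t => by simpa using hp t
    choose c q hq hpq using fun t => exists_eq_C_mul_add_X_mul (hp' t)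
    have hsplit : ∑ t, (C (c t) * X 1 ^ ((N : ℤ) - a t).toNat : Poly2 k) • e t
        = -((X 0 : Poly2 k) • ∑ t, q t • e t) := by
      rw [eq_neg_iff_add_eq_zero, Finset.smul_sum, ← Finset.sum_add_distrib, ← hrel]
      refine Finset.sum_congr rfl fun t _ => ?_
      rw [smul_smul, ← add_smul, ← hpq]
    by_cases hc : ∀ t, c t = 0
    · have hq0 : q = 0 := by
        refine ih q (fun t => ?_) ?_
        · convert hq t using 2
          ring
        · simp only [hc, map_zero, zero_mul, zero_smul, Finset.sum_const_zero] at hsplit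
          exact (smul_eq_zero.1 (neg_eq_zero.1 hsplit.symm)).resolve_left (X_ne_zero 0)
      funext t
      rw [hpq t, hc t, hq0]
      simp
    · exfalso
      push Not at hc
      obtain ⟨t₀, ht₀, hmax⟩ := Finset.exists_max_image (Finset.univ.filter fun t => c t ≠ 0) a
        (by obtain ⟨t, ht⟩ := hc; exact ⟨t, by simpa using ht⟩)
      have hc₀ : c t₀ ≠ 0 := by simpa using ht₀
      have hle : ∀ t, c t ≠ 0 → a t ≤ N := by
        intro t ht
        by_contra hlt
        have h0 : (N : ℤ) - a t < 0 := by omega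
        have h1 := hpq t
        rw [eq_zero_of_mem_polyDeg_neg h0 (hp' t),
          eq_zero_of_mem_polyDeg_neg (by omega) (hq t), Int.toNat_of_nonpos h0.le] at h1
        exact ht (by simpa using h1.symm)
      let w : Fin n → Poly2 k := ∑ t, (C (c t) * X 1 ^ (a t₀ - a t) : Poly2 k) • e t
      have hw : (X 1 ^ (N - a t₀) : Poly2 k) • w = -((X 0 : Poly2 k) • ∑ t, q t • e t) := by
        rw [← hsplit, Finset.smul_sum]
        refine Finset.sum_congr rfl fun t _ => ?_
        by_cases ht : c t = 0
        · simp [ht]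
        · have h1 := hle t ht
          have h2 := hmax t (by simpa using ht)
          have h3 := hle t₀ hc₀
          have h4 : ((N : ℤ) - a t).toNat = (N - a t₀) + (a t₀ - a t) := by omega
          rw [smul_smul, h4, pow_add]
          congr 1
          ring
      have hdvd : ∀ l, (X 0 : Poly2 k) ∣ w l := by
        intro l
        have h1 : (X 0 : Poly2 k) ∣ X 1 ^ (N - a t₀) * w l := by
          have := congrFun hw l
          simp only [Pi.smul_apply, Pi.neg_apply, smul_eq_mul] at this
          rw [this, dvd_neg]
          exact dvd_mul_right _ _
        refine ((prime_X 0).dvd_or_dvd h1).resolve_left fun h2 => ?_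
        have := (prime_X 0).dvd_of_dvd_pow h2
        rw [MvPolynomial.X_dvd_X] at this
        simp at this
      choose w' hw' using hdvd
      have hww' : w = (X 0 : Poly2 k) • w' := funext hw'
      have hwhom : IsHomVec (a t₀ - 1 + 1) w := by
        intro l
        rw [sub_add_cancel]
        simp only [w, Finset.sum_apply, Pi.smul_apply, smul_eq_mul]
        refine sum_mem fun t _ => ?_
        by_cases ht : c t = 0
        · simp [ht, zero_mem]
        · have h2 := hmax t (by simpa using ht)
          have := mul_mem_polyDeg (C_mul_mem_polyDeg (c t)
            (X_pow_mem_polyDeg (k := k) 1 (a t₀ - a t))) (he.1 t l)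
          rwa [show ((a t₀ - a t : ℕ) : ℤ) + a t = a t₀ by omega] at this
      have hw'hom : IsHomVec (a t₀ - 1) w' := by
        rw [hww'] at hwhom
        exact hwhom.of_X_smul
      have heK : ∀ t, e t ∈ K := fun t => he.2 ▸ Submodule.subset_span ⟨t, rfl⟩
      have hw'K : w' ∈ K := by
        refine hsat _ ?_
        rw [← hww']
        exact sum_mem fun t _ => Submodule.smul_mem _ _ (heK t)
      rw [← he.2] at hw'K
      obtain ⟨g, hg⟩ := (Submodule.mem_span_range_iff_exists_fun _).1 hw'K
      have hg' : w' = ∑ t, polyComp ((a t₀ : ℤ) - 1 - a t) (g t) • e t := by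
        rw [← vecComp_of_isHomVec hw'hom, ← hg, map_sum]
        exact Finset.sum_congr rfl fun t _ => vecComp_smul_of_mem _ (he.1 t)
      let L := Submodule.span (Poly2 k) (e '' {t | t ≠ t₀})
      have hL : ∀ t, t ≠ t₀ → e t ∈ L := fun t ht => Submodule.subset_span ⟨t, ht, rfl⟩
      have hw'L : w' ∈ L := by
        rw [hg']
        refine sum_mem fun t _ => ?_
        by_cases ht : t = t₀
        · rw [ht, eq_zero_of_mem_polyDeg_neg (by omega) (polyComp_mem _ (g t₀)), zero_smul]
          exact zero_mem _
        · exact Submodule.smul_mem _ _ (hL t ht)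
      have he₀ : e t₀ ∈ L := by
        have h1 : w ∈ L := hww' ▸ Submodule.smul_mem _ _ hw'L
        have h2 : w = (C (c t₀) : Poly2 k) • e t₀ + ∑ t ∈ Finset.univ.erase t₀,
            (C (c t) * X 1 ^ (a t₀ - a t) : Poly2 k) • e t := by
          have := Finset.add_sum_erase Finset.univ
            (fun t => (C (c t) * X 1 ^ (a t₀ - a t) : Poly2 k) • e t) (Finset.mem_univ t₀)
          simp only [Nat.sub_self, pow_zero, mul_one] at this
          exact this.symm
        have h3 : (C (c t₀) : Poly2 k) • e t₀ ∈ L := by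
          rw [eq_sub_of_add_eq h2.symm]
          refine sub_mem h1 (sum_mem fun t ht => Submodule.smul_mem _ _ (hL t ?_))
          exact (Finset.mem_erase.1 ht).1
        have h4 := Submodule.smul_mem L (C (c t₀)⁻¹) h3
        rwa [smul_smul, ← map_mul, inv_mul_cancel₀ hc₀, map_one, one_smul] at h4
      obtain ⟨s', rfl⟩ : ∃ s', s = s' + 1 := ⟨s - 1, by have := t₀.2; omega⟩
      refine hmin s' (Nat.lt_succ_self s') (a ∘ t₀.succAbove) (e ∘ t₀.succAbove)
        ⟨fun t => he.1 _, ?_⟩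
      have hrange : Set.range (e ∘ t₀.succAbove) = e '' {t | t ≠ t₀} := by
        rw [Set.range_comp, Fin.range_succAbove]
        rfl
      rw [hrange, ← he.2]
      refine le_antisymm (Submodule.span_mono (Set.image_subset_range _ _))
        (Submodule.span_le.2 ?_)
      rintro _ ⟨t, rfl⟩
      by_cases ht : t = t₀
      · rw [ht]
        exact he₀
      · exact hL t ht

/-- A graded submodule of `R ^ n`, `R = k[x₀, x₁]`, that is saturated with respect to `X 0` has a
finite basis of homogeneous vectors. -/
theorem exists_homogeneous_basis (K : Submodule (Poly2 k) (Fin n → Poly2 k))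
    (hgr : ∀ v ∈ K, ∀ i, vecComp i v ∈ K) (hsat : ∀ v, (X 0 : Poly2 k) • v ∈ K → v ∈ K) :
    ∃ (s : ℕ) (a : Fin s → ℕ) (b : Module.Basis (Fin s) (Poly2 k) K),
      ∀ t, IsHomVec (a t) (b t : Fin n → Poly2 k) := by
  classical
  have hex := exists_isHomGenerating hgr
  obtain ⟨a, e, he⟩ := Nat.find_spec hex
  have hmin : ∀ s' < Nat.find hex, ∀ (a' : Fin s' → ℕ) (e' : Fin s' → Fin n → Poly2 k),
      ¬ IsHomGenerating K a' e' :=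
    fun s' hs' a' e' h => Nat.find_min hex hs' ⟨a', e', h⟩
  have hli : LinearIndependent (Poly2 k) e := by
    rw [Fintype.linearIndependent_iff]
    intro g hg t
    have hD : ∀ D : ℕ, ∀ t, polyComp ((D + 1 : ℕ) - 1 - a t : ℤ) (g t) = 0 := by
      intro D
      refine congrFun (he.relation_eq_zero hsat hmin (D + 1)
        (fun t => polyComp ((D + 1 : ℕ) - 1 - a t : ℤ) (g t)) (fun t => polyComp_mem _ _) ?_)
      have := congrArg (vecComp ((D + 1 : ℕ) - 1 : ℤ)) hg
      rw [map_sum, map_zero] at this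
      rw [← this]
      exact Finset.sum_congr rfl fun t _ => (vecComp_smul_of_mem _ (he.1 t)).symm
    obtain ⟨T, -, hT⟩ := exists_sum_polyComp (g t) ∅
    rw [hT]
    refine Finset.sum_eq_zero fun i _ => ?_
    rcases lt_or_ge i 0 with hi | hi
    · exact eq_zero_of_mem_polyDeg_neg hi (polyComp_mem _ _)
    · lift i to ℕ using hi
      have := hD (i + a t) t
      rwa [show ((i + a t + 1 : ℕ) : ℤ) - 1 - a t = i by push_cast; ring] at this
  refine ⟨_, a, (Module.Basis.span hli).map (LinearEquiv.ofEq _ _ he.2), fun t => ?_⟩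
  rw [Module.Basis.map_apply, LinearEquiv.coe_ofEq_apply, Module.Basis.span_apply]
  exact he.1 t

end HomogeneousBasis

/-! ### The cokernel of a matrix and its bidual -/

section Bidual

variable {R : Type*} [CommRing R] {N : Type*} [AddCommGroup N] [Module R N]

/-- If multiplication by `r` on `N` factors through a finite free module, then it factors through
the canonical map from `N` to its bidual, and multiplication by `r` on the bidual does so, too. -/
theorem exists_bidual_section {ι : Type*} [Fintype ι] (r : R) (l : ι → Module.Dual R N) (x : ι → N)
    (h : ∀ e, r • e = ∑ i, l i e • x i) :
    ∃ μ : Module.Dual R (Module.Dual R N) →ₗ[R] N,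
      (∀ u, Module.Dual.eval R N (μ u) = r • u) ∧ ∀ e, μ (Module.Dual.eval R N e) = r • e := by
  refine ⟨∑ i, (Module.Dual.eval R (Module.Dual R N) (l i)).smulRight (x i), fun u => ?_,
    fun e => ?_⟩
  · ext ψ
    have hψ : r • ψ = ∑ i, ψ (x i) • l i := by
      ext e
      rw [LinearMap.smul_apply, ← map_smul, h, map_sum, LinearMap.sum_apply]
      refine Finset.sum_congr rfl fun i _ => ?_
      rw [map_smul, LinearMap.smul_apply, smul_eq_mul, smul_eq_mul, mul_comm]
    rw [LinearMap.smul_apply, ← map_smul, hψ, map_sum]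
    simp [LinearMap.sum_apply, mul_comm]
  · rw [h]
    simp [LinearMap.sum_apply]

end Bidual

section CokerBidual

variable {k : Type*} [Field k] {n m : ℕ} (A : Matrix (Fin n) (Fin m) (Poly2 k))

/-- The projection `R ^ n → E`. -/
noncomputable def mkE : (Fin n → Poly2 k) →ₗ[Poly2 k] ModE A :=
  Submodule.mkQ (LinearMap.range A.mulVecLin)

theorem mkE_surjective : Function.Surjective (mkE A) := Submodule.mkQ_surjective _

theorem mkE_eq_zero_iff {v : Fin n → Poly2 k} : mkE A v = 0 ↔ ∃ w, A.mulVec w = v :=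
  Submodule.Quotient.mk_eq_zero _

theorem mem_degE_iff {i : ℤ} {e : ModE A} :
    e ∈ degE A i ↔ ∃ v, IsHomVec i v ∧ mkE A v = e := by
  constructor
  · rintro ⟨v, hv, rfl⟩
    exact ⟨v, fun l => hv l trivial, rfl⟩
  · rintro ⟨v, hv, rfl⟩
    exact ⟨v, fun l _ => hv l, rfl⟩

theorem dual_mkE (ψ : Module.Dual (Poly2 k) (ModE A)) (v : Fin n → Poly2 k) :
    ψ (mkE A v) = ∑ l, v l * ψ (mkE A (Pi.single l 1)) := by
  conv_lhs => rw [pi_eq_sum_univ' v]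
  simp

theorem mem_dualDeg_degE_iff {j : ℤ} {ψ : Module.Dual (Poly2 k) (ModE A)} :
    ψ ∈ dualDeg (degE A) j ↔ ∀ l, ψ (mkE A (Pi.single l 1)) ∈ polyDeg k j := by
  constructor
  · intro h l
    have := h 0 (mkE A (Pi.single l 1)) ((mem_degE_iff A).2 ⟨_, fun t => ?_, rfl⟩)
    · rwa [zero_add] at this
    · by_cases htl : t = l
      · subst htl
        simpa using C_mem_polyDeg (1 : k)
      · simp [htl, zero_mem]
  · intro h i e he
    obtain ⟨v, hv, rfl⟩ := (mem_degE_iff A).1 he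
    rw [dual_mkE]
    exact sum_mem fun l _ => mul_mem_polyDeg (hv l) (h l)

/-- The dual of `E`, as the module of relations among the rows of the matrix. -/
noncomputable def dualEquivKer :
    Module.Dual (Poly2 k) (ModE A) ≃ₗ[Poly2 k] LinearMap.ker A.vecMulLinear := by
  refine LinearEquiv.ofBijective
    ((LinearMap.pi fun l => Module.Dual.eval _ _ (mkE A (Pi.single l 1))).codRestrict _ ?_)
    ⟨?_, ?_⟩
  · intro ψ
    rw [LinearMap.mem_ker]
    funext j
    have h : ψ (mkE A (A.mulVec (Pi.single j 1))) = 0 := by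
      rw [(mkE_eq_zero_iff A).2 ⟨_, rfl⟩, map_zero]
    rw [dual_mkE] at h
    simp only [Matrix.mulVec_single_one, Matrix.col_apply] at h
    simpa [Matrix.vecMul, dotProduct, mul_comm] using h
  · intro ψ ψ' h
    refine LinearMap.ext fun e => ?_
    obtain ⟨v, rfl⟩ := mkE_surjective A e
    rw [dual_mkE, dual_mkE]
    refine Finset.sum_congr rfl fun l _ => ?_
    have := congrFun (congrArg Subtype.val h) l
    simp only [LinearMap.codRestrict_apply, LinearMap.pi_apply, Module.Dual.eval_apply] at this
    rw [this]
  · rintro ⟨v, hv⟩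
    have hle : LinearMap.range A.mulVecLin ≤
        LinearMap.ker (Fintype.linearCombination (Poly2 k) v) := by
      rintro _ ⟨w, rfl⟩
      rw [LinearMap.mem_ker, Fintype.linearCombination_apply]
      have h1 : dotProduct v (A.mulVec w) = 0 := by
        rw [Matrix.dotProduct_mulVec, show Matrix.vecMul v A = 0 from hv, zero_dotProduct]
      simpa [dotProduct, mul_comm] using h1
    refine ⟨Submodule.liftQ _ (Fintype.linearCombination (Poly2 k) v) hle,
      Subtype.ext (funext fun l => ?_)⟩
    change Submodule.liftQ (LinearMap.range A.mulVecLin)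
      (Fintype.linearCombination (Poly2 k) v) hle (mkE A (Pi.single l 1)) = v l
    rw [mkE, Submodule.mkQ_apply, Submodule.liftQ_apply]
    simp [Fintype.linearCombination_apply, Pi.single_apply]

theorem dualEquivKer_apply (ψ : Module.Dual (Poly2 k) (ModE A)) (l : Fin n) :
    (dualEquivKer A ψ : Fin n → Poly2 k) l = ψ (mkE A (Pi.single l 1)) := rfl

variable {A}

/-- The dual of the cokernel of a matrix with homogeneous columns has a finite basis of functionals
of nonnegative degrees. -/
theorem exists_homogeneous_dual_basis {δ : Fin m → ℕ} (hA : ∀ l j, A l j ∈ polyDeg k (δ j)) :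
    ∃ (s : ℕ) (a : Fin s → ℕ) (b : Module.Basis (Fin s) (Poly2 k) (Module.Dual (Poly2 k) (ModE A))),
      ∀ t, b t ∈ dualDeg (degE A) (a t) := by
  have hker : ∀ v, v ∈ LinearMap.ker A.vecMulLinear ↔ ∀ j, ∑ l, v l * A l j = 0 := by
    intro v
    rw [LinearMap.mem_ker, funext_iff]
    rfl
  obtain ⟨s, a, b, hb⟩ := exists_homogeneous_basis (LinearMap.ker A.vecMulLinear)
    (fun v hv i => by
      rw [hker] at hv ⊢
      intro j
      have := congrArg (polyComp (i + δ j)) (hv j)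
      rw [map_sum, map_zero] at this
      rw [← this]
      refine Finset.sum_congr rfl fun l _ => ?_
      rw [polyComp_mul_of_mem _ (hA l j), add_sub_cancel_right, vecComp_apply])
    (fun v hv => by
      rw [LinearMap.mem_ker, map_smul] at hv
      exact (smul_eq_zero.1 hv).resolve_left (X_ne_zero 0))
  refine ⟨s, a, b.map (dualEquivKer A).symm, fun t => (mem_dualDeg_degE_iff A).2 fun l => ?_⟩
  rw [← dualEquivKer_apply, Module.Basis.map_apply, LinearEquiv.apply_symm_apply]
  exact hb t l

section Basis

variable {s : ℕ} {a : Fin s → ℕ}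
  {b : Module.Basis (Fin s) (Poly2 k) (Module.Dual (Poly2 k) (ModE A))}

theorem mem_degF_iff (hb : ∀ t, b t ∈ dualDeg (degE A) (a t)) {i : ℤ} {u : ModF A} :
    u ∈ degF A i ↔ ∀ t, u (b t) ∈ polyDeg k (i + a t) := by
  constructor
  · intro h t
    rw [add_comm]
    exact h _ _ (hb t)
  · intro h j x hx
    have hx' : x = ∑ t, polyComp (j - a t) (b.repr x t) • b t := by
      refine LinearMap.ext fun e => ?_
      obtain ⟨v, rfl⟩ := mkE_surjective A e
      rw [dual_mkE, dual_mkE]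
      refine Finset.sum_congr rfl fun l _ => ?_
      congr 1
      conv_lhs => rw [← polyComp_of_mem ((mem_dualDeg_degE_iff A).1 hx l), ← b.sum_repr x]
      rw [LinearMap.sum_apply, LinearMap.sum_apply, map_sum]
      refine Finset.sum_congr rfl fun t _ => ?_
      exact polyComp_mul_of_mem _ ((mem_dualDeg_degE_iff A).1 (hb t) l)
    rw [hx', map_sum]
    refine sum_mem fun t _ => ?_
    rw [map_smul, smul_eq_mul]
    have := mul_mem_polyDeg (polyComp_mem (j - a t) (b.repr x t)) (h t)
    rwa [show j - a t + (i + a t) = j + i by ring] at this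

theorem toF_mkE_eq_toF_vecComp (hb : ∀ t, b t ∈ dualDeg (degE A) (a t)) {i : ℤ}
    {v : Fin n → Poly2 k} (hv : toF A (mkE A v) ∈ degF A i) :
    toF A (mkE A v) = toF A (mkE A (vecComp i v)) := by
  refine b.ext fun t => ?_
  have h1 := polyComp_of_mem ((mem_degF_iff hb).1 hv t)
  rw [← h1]
  change polyComp _ (b t (mkE A v)) = b t (mkE A (vecComp i v))
  rw [dual_mkE, dual_mkE, map_sum]
  refine Finset.sum_congr rfl fun l _ => ?_
  rw [polyComp_mul_of_mem _ ((mem_dualDeg_degE_iff A).1 (hb t) l), add_sub_cancel_right,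
    vecComp_apply]

theorem mkE_eq_zero_of_X_pow_smul (hAinj : Function.Injective A.mulVecLin) {N : ℕ} {e : ModE A}
    (h : ∀ t : Fin 2, (X t ^ N : Poly2 k) • e = 0) : e = 0 := by
  obtain ⟨v, rfl⟩ := mkE_surjective A e
  have h0 := h 0
  have h1 := h 1
  rw [← map_smul, mkE_eq_zero_iff] at h0 h1
  obtain ⟨w, hw⟩ := h0
  obtain ⟨w', hw'⟩ := h1
  have hww' : (X 1 ^ N : Poly2 k) • w = (X 0 ^ N : Poly2 k) • w' := by
    apply hAinj
    rw [Matrix.mulVecLin_apply, Matrix.mulVecLin_apply, Matrix.mulVec_smul, Matrix.mulVec_smul, hw,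
      hw', smul_comm]
  choose r hr hr' using fun j => X_zero_pow_dvd_of_mul (congrFun hww' j)
  refine (mkE_eq_zero_iff A).2 ⟨r, ?_⟩
  have hwr : w = (X 0 ^ N : Poly2 k) • r := funext hr
  rw [hwr, Matrix.mulVec_smul] at hw
  exact smul_right_injective _ (pow_ne_zero N (X_ne_zero (R := k) (0 : Fin 2))) hw

theorem toF_injective (hAinj : Function.Injective A.mulVecLin) {N : ℕ}
    {μ : Fin 2 → ModF A →ₗ[Poly2 k] ModE A}
    (hμ : ∀ t e, μ t (toF A e) = (X t ^ N : Poly2 k) • e) : Function.Injective (toF A) := by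
  rw [injective_iff_map_eq_zero]
  intro e he
  refine mkE_eq_zero_of_X_pow_smul hAinj (N := N) fun t => ?_
  rw [← hμ, he, map_zero]

/-- The vanishing of `F / E` in degrees at least `d_m - 1`. For `u ∈ F` of such a degree, write
`x₀ ^ N u` and `x₁ ^ N u` as classes of vectors `v₀`, `v₁`. The coefficients of the relation
`x₁ ^ N v₀ - x₀ ^ N v₁ = A w` have degrees at least `2 N - 1`, so they lie in the ideal
`(x₀ ^ N, x₁ ^ N)`, and `v₀`, `v₁` can be changed to satisfy `x₁ ^ N v₀ = x₀ ^ N v₁`. -/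
theorem exists_isHomVec_toF_eq (hAinj : Function.Injective A.mulVecLin) {δ : Fin m → ℕ}
    (hA : ∀ l j, A l j ∈ polyDeg k (δ j)) {N : ℕ} {μ : Fin 2 → ModF A →ₗ[Poly2 k] ModE A}
    (hμ : ∀ t e, μ t (toF A e) = (X t ^ N : Poly2 k) • e)
    (hμ' : ∀ t u, toF A (μ t u) = (X t ^ N : Poly2 k) • u)
    (hb : ∀ t, b t ∈ dualDeg (degE A) (a t)) {i : ℤ} (hi : ∀ j, (δ j : ℤ) - 1 ≤ i) {u : ModF A}
    (hu : u ∈ degF A i) : ∃ v, IsHomVec i v ∧ toF A (mkE A v) = u := by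
  have hinj := toF_injective hAinj hμ
  have hex : ∀ t : Fin 2, ∃ v, IsHomVec (N + i) v ∧ toF A (mkE A v) = (X t ^ N : Poly2 k) • u := by
    intro t
    obtain ⟨v, hv⟩ := mkE_surjective A (μ t u)
    have h1 : toF A (mkE A v) = (X t ^ N : Poly2 k) • u := by rw [hv, hμ']
    refine ⟨vecComp (N + i) v, isHomVec_vecComp _ _, ?_⟩
    rw [← toF_mkE_eq_toF_vecComp hb, h1]
    rw [h1, mem_degF_iff hb]
    intro t'
    rw [LinearMap.smul_apply, add_assoc]
    exact mul_mem_polyDeg (X_pow_mem_polyDeg t N) ((mem_degF_iff hb).1 hu t')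
  obtain ⟨v₀, hv₀, hv₀u⟩ := hex 0
  obtain ⟨v₁, hv₁, hv₁u⟩ := hex 1
  have hzero : mkE A ((X 1 ^ N : Poly2 k) • v₀ - (X 0 ^ N : Poly2 k) • v₁) = 0 := by
    apply hinj
    rw [map_sub, map_smul, map_smul, map_sub, map_smul, map_smul, hv₀u, hv₁u, map_zero, smul_comm,
      sub_self]
  obtain ⟨w, hw⟩ := (mkE_eq_zero_iff A).1 hzero
  have hwhom : ∀ j, w j ∈ polyDeg k (N + (N + i) - δ j) := by
    have : w = fun j => polyComp (N + (N + i) - δ j) (w j) := by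
      apply hAinj
      rw [Matrix.mulVecLin_apply, Matrix.mulVecLin_apply]
      have hvec : IsHomVec (N + (N + i)) ((X 1 ^ N : Poly2 k) • v₀ - (X 0 ^ N : Poly2 k) • v₁) :=
        fun l => sub_mem (mul_mem_polyDeg (X_pow_mem_polyDeg 1 N) (hv₀ l))
          (mul_mem_polyDeg (X_pow_mem_polyDeg 0 N) (hv₁ l))
      rw [hw, ← vecComp_of_isHomVec hvec, ← hw]
      funext l
      simp only [vecComp_apply, Matrix.mulVec, dotProduct, map_sum]
      exact Finset.sum_congr rfl fun j _ => polyComp_mul_of_mem' _ (hA l j)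
    rw [this]
    exact fun j => polyComp_mem _ _
  choose w₀ w₁ hw' using fun j =>
    exists_eq_X_pow_combination (N := N) (by have := hi j; omega) (hwhom j)
  have hw'' : w = (X 1 ^ N : Poly2 k) • w₀ - (X 0 ^ N : Poly2 k) • w₁ := funext hw'
  have hrel : (X 1 ^ N : Poly2 k) • (v₀ - A.mulVec w₀) =
      (X 0 ^ N : Poly2 k) • (v₁ - A.mulVec w₁) := by
    rw [hw'', Matrix.mulVec_sub, Matrix.mulVec_smul, Matrix.mulVec_smul] at hw
    rw [smul_sub, smul_sub, sub_eq_sub_iff_sub_eq_sub, hw]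
  choose v hv hv' using fun l => X_zero_pow_dvd_of_mul (congrFun hrel l)
  have hvv : v₀ - A.mulVec w₀ = (X 0 ^ N : Poly2 k) • v := funext hv
  have huv : toF A (mkE A v) = u := by
    have h0 : (X 0 ^ N : Poly2 k) ≠ 0 := pow_ne_zero N (X_ne_zero 0)
    have h1 : (X 0 ^ N : Poly2 k) • toF A (mkE A v) = (X 0 ^ N : Poly2 k) • u := by
      rw [← map_smul, ← map_smul, ← hvv, map_sub, (mkE_eq_zero_iff A).2 ⟨w₀, rfl⟩, sub_zero, hv₀u]
    refine LinearMap.ext fun ψ => mul_left_cancel₀ h0 ?_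
    exact LinearMap.congr_fun h1 ψ
  refine ⟨vecComp i v, isHomVec_vecComp _ _, ?_⟩
  rw [← toF_mkE_eq_toF_vecComp hb (huv ▸ hu), huv]

end Basis

/-- Let `φ` be injective with image the syzygies of `f`, and let `A` consist of the first columns
of `φ`. If `r` is in the ideal generated by `f`, then multiplication by `r` on `E` factors through
the free module spanned by a preimage of `r` and the remaining columns of `φ`. -/
theorem exists_free_factorization {q : ℕ} (hm : m ≤ q) {f : Fin n → Poly2 k}
    {φ : Matrix (Fin n) (Fin q) (Poly2 k)} (hφ_inj : Function.Injective φ.mulVecLin)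
    (hφ_exact : ∀ v : Fin n → Poly2 k, v ∈ LinearMap.range φ.mulVecLin ↔ ∑ i, v i * f i = 0)
    (hA : A = φ.submatrix id (Fin.castLE hm)) {r : Poly2 k} (hr : r ∈ Ideal.span (Set.range f)) :
    ∃ (l : Option (Fin q) → Module.Dual (Poly2 k) (ModE A)) (x : Option (Fin q) → ModE A),
      ∀ e, r • e = ∑ i, l i e • x i := by
  classical
  obtain ⟨h, hh⟩ := (Ideal.mem_span_range_iff_exists_fun).1 hr
  let F₀ : (Fin n → Poly2 k) →ₗ[Poly2 k] Poly2 k := Fintype.linearCombination (Poly2 k) f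
  have hF₀ : ∀ v, F₀ v = ∑ i, v i * f i := fun v => Fintype.linearCombination_apply _ _ _
  have hexact : ∀ v, v ∈ LinearMap.range φ.mulVecLin ↔ F₀ v = 0 := fun v => by
    rw [hφ_exact, hF₀]
  -- `r • v - F₀ v • h` is a syzygy of `f`; `W v` is its coordinate vector.
  let W₀ : (Fin n → Poly2 k) →ₗ[Poly2 k] LinearMap.range φ.mulVecLin :=
    (r • LinearMap.id - F₀.smulRight h).codRestrict _ fun v => by
      rw [hexact]
      simp only [LinearMap.sub_apply, LinearMap.smul_apply, LinearMap.id_apply,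
        LinearMap.smulRight_apply, map_sub, map_smul, smul_eq_mul]
      rw [hF₀ h, hh]
      ring
  let W : (Fin n → Poly2 k) →ₗ[Poly2 k] (Fin q → Poly2 k) :=
    (LinearEquiv.ofInjective φ.mulVecLin hφ_inj).symm.toLinearMap ∘ₗ W₀
  have hW : ∀ v, φ.mulVec (W v) = r • v - F₀ v • h := fun v => by
    have := LinearEquiv.apply_symm_apply (LinearEquiv.ofInjective φ.mulVecLin hφ_inj) (W₀ v)
    exact congrArg Subtype.val this
  -- The image of `A` consists of the vectors whose coordinates outside the first columns vanish.
  let pad : (Fin m → Poly2 k) → Fin q → Poly2 k := fun w j =>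
    if hj : (j : ℕ) < m then w ⟨j, hj⟩ else 0
  have hpad : ∀ w, A.mulVec w = φ.mulVec (pad w) := by
    intro w
    funext l
    simp only [hA, Matrix.mulVec, dotProduct, Matrix.submatrix_apply, id]
    refine Finset.sum_of_injOn (Fin.castLE hm) (Fin.castLE_injective hm).injOn (by simp) ?_ ?_
    · intro j _ hj
      have : ¬ (j : ℕ) < m := fun hjm => hj ⟨⟨j, hjm⟩, by simp, rfl⟩
      simp [pad, this]
    · intro j _
      simp [pad]
  have hF₀A : ∀ w, F₀ (A.mulVec w) = 0 := fun w => (hexact _).1 (hpad w ▸ ⟨_, rfl⟩)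
  have hWA : ∀ w, W (A.mulVec w) = r • pad w := by
    intro w
    apply hφ_inj
    rw [Matrix.mulVecLin_apply, Matrix.mulVecLin_apply, hW, hF₀A, zero_smul, sub_zero,
      Matrix.mulVec_smul, hpad]
  let l : Option (Fin q) → Module.Dual (Poly2 k) (ModE A) := fun o => match o with
    | none => Submodule.liftQ _ F₀ (by rintro _ ⟨w, rfl⟩; exact hF₀A w)
    | some j => if hj : (j : ℕ) < m then 0 else
        Submodule.liftQ _ (LinearMap.proj j ∘ₗ W) (by
          rintro _ ⟨w, rfl⟩
          rw [LinearMap.mem_ker, LinearMap.comp_apply, Matrix.mulVecLin_apply, hWA]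
          simp [pad, hj])
  let x : Option (Fin q) → ModE A := fun o => match o with
    | none => mkE A h
    | some j => mkE A (fun i => φ i j)
  refine ⟨l, x, fun e => ?_⟩
  obtain ⟨v, rfl⟩ := mkE_surjective A e
  rw [Fintype.sum_option]
  have h1 : l none (mkE A v) = F₀ v := Submodule.liftQ_apply _ _ _
  have h2 : ∀ j, l (some j) (mkE A v) • x (some j) = W v j • mkE A (fun i => φ i j) := by
    intro j
    by_cases hj : (j : ℕ) < m
    · have h3 : mkE A (fun i => φ i j) = 0 := by
        refine (mkE_eq_zero_iff A).2 ⟨Pi.single ⟨j, hj⟩ 1, ?_⟩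
        rw [Matrix.mulVec_single_one, hA]
        rfl
      simp only [x, h3, smul_zero]
    · have h4 : l (some j) (mkE A v) = W v j := by
        simp only [l, hj, dif_neg, not_false_eq_true]
        exact Submodule.liftQ_apply _ _ _
      rw [h4]
  rw [h1, Finset.sum_congr rfl fun j _ => h2 j]
  simp only [x, ← map_smul, ← map_sum, ← map_add]
  congr 1
  have h5 : ∑ j, W v j • (fun i => φ i j) = φ.mulVec (W v) := by
    funext i
    simp [Matrix.mulVec, dotProduct, Finset.sum_apply, mul_comm]
  rw [h5, hW]
  simp

end CokerBidual

/-! ### Rees algebras of modules -/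

section ReesGeneral

variable {R : Type*} [CommRing R] {N P : Type*} [AddCommGroup N] [Module R N] [AddCommGroup P]
  [Module R P]

theorem rees_eq_zero_of_smul_eq_zero {r : R} (hr : r ∈ nonZeroDivisors R) {z : Rees R N}
    (h : r • z = 0) : z = 0 := by
  obtain ⟨a, rfl⟩ := Ideal.Quotient.mkₐ_surjective R (symTorsion R N) z
  rw [← map_smul, Ideal.Quotient.mkₐ_eq_mk, Ideal.Quotient.eq_zero_iff_mem] at h
  rw [Ideal.Quotient.mkₐ_eq_mk, Ideal.Quotient.eq_zero_iff_mem]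
  obtain ⟨s, hs, hsa⟩ := h
  exact ⟨s * r, mul_mem hs hr, by rw [mul_smul, hsa]⟩

theorem algebraMap_rees_mem_nonZeroDivisors {r : R} (hr : r ∈ nonZeroDivisors R) :
    algebraMap R (Rees R N) r ∈ nonZeroDivisors (Rees R N) := by
  rw [mem_nonZeroDivisors_iff_right]
  intro z hz
  refine rees_eq_zero_of_smul_eq_zero hr ?_
  exact (Algebra.smul_def r z).trans ((mul_comm _ _).trans hz)

@[simp] theorem reesMap_reesι (f : N →ₗ[R] P) (y : N) :
    reesMap f (reesι R N y) = reesι R P (f y) := by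
  have : reesMap f (Ideal.Quotient.mkₐ R (symTorsion R N) (SymmetricAlgebra.ι R N y)) =
      (Ideal.Quotient.mkₐ R (symTorsion R P))
        (SymmetricAlgebra.lift (SymmetricAlgebra.ι R P ∘ₗ f) (SymmetricAlgebra.ι R N y)) := rfl
  rw [SymmetricAlgebra.lift_ι_apply] at this
  exact this

theorem rees_algHom_ext {B : Type*} [CommRing B] [Algebra R B] {f g : Rees R N →ₐ[R] B}
    (h : ∀ y, f (reesι R N y) = g (reesι R N y)) : f = g := by
  refine Ideal.Quotient.algHom_ext _ (SymmetricAlgebra.algHom_ext ?_)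
  exact LinearMap.ext h

theorem adjoin_range_reesι : Algebra.adjoin R (Set.range (reesι R N)) = ⊤ := by
  rw [eq_top_iff]
  rintro z -
  obtain ⟨a, rfl⟩ := Ideal.Quotient.mkₐ_surjective R (symTorsion R N) z
  induction a using SymmetricAlgebra.induction with
  | algebraMap r =>
    rw [AlgHom.commutes]
    exact Subalgebra.algebraMap_mem _ r
  | ι y => exact Algebra.subset_adjoin ⟨y, rfl⟩
  | mul a b ha hb =>
    rw [map_mul]
    exact mul_mem ha hb
  | add a b ha hb =>
    rw [map_add]
    exact add_mem ha hb

/-- The universal property of the Rees algebra: a linear map to a torsion-free algebra extends. -/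
noncomputable def reesLift {B : Type*} [CommRing B] [Algebra R B]
    (hB : ∀ r ∈ nonZeroDivisors R, ∀ b : B, r • b = 0 → b = 0) (f : N →ₗ[R] B) :
    Rees R N →ₐ[R] B :=
  Ideal.Quotient.liftₐ (symTorsion R N) (SymmetricAlgebra.lift f) (by
    rintro a ⟨r, hr, ha⟩
    exact hB r hr _ (by rw [← map_smul, ha, map_zero]))

@[simp] theorem reesLift_reesι {B : Type*} [CommRing B] [Algebra R B]
    (hB : ∀ r ∈ nonZeroDivisors R, ∀ b : B, r • b = 0 → b = 0) (f : N →ₗ[R] B) (y : N) :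
    reesLift hB f (reesι R N y) = f y := by
  have : reesLift hB f (Ideal.Quotient.mkₐ R (symTorsion R N) (SymmetricAlgebra.ι R N y)) =
      SymmetricAlgebra.lift f (SymmetricAlgebra.ι R N y) := rfl
  rw [SymmetricAlgebra.lift_ι_apply] at this
  exact this

theorem isUnit_algebraMap_fractionRing_rees {r : R} (hr : r ∈ nonZeroDivisors R) :
    IsUnit (algebraMap R (FractionRing (Rees R N)) r) := by
  rw [IsScalarTower.algebraMap_apply R (Rees R N)]
  exact IsLocalization.map_units (FractionRing (Rees R N))
    ⟨_, algebraMap_rees_mem_nonZeroDivisors hr⟩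

/-- A linear map `μ : P → N` that should be thought of as multiplication by `r` gives the
homomorphism from the Rees algebra of `P` to the total quotient ring of that of `N` that maps
`y ∈ P` to the fraction `μ y / r`. -/
theorem exists_rees_to_fractionRing {r : R} (hr : r ∈ nonZeroDivisors R) (μ : P →ₗ[R] N) :
    ∃ g : Rees R P →ₐ[R] FractionRing (Rees R N),
      ∀ y, r • g (reesι R P y) = algebraMap _ (FractionRing (Rees R N)) (reesι R N (μ y)) := by
  obtain ⟨u, hu⟩ := isUnit_algebraMap_fractionRing_rees (N := N) hr
  have hB : ∀ r ∈ nonZeroDivisors R, ∀ b : FractionRing (Rees R N), r • b = 0 → b = 0 := by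
    intro s hs b hb
    rw [Algebra.smul_def] at hb
    exact (isUnit_algebraMap_fractionRing_rees hs).mul_right_eq_zero.1 hb
  let f : P →ₗ[R] FractionRing (Rees R N) :=
    LinearMap.mulLeft R (↑u⁻¹ : FractionRing (Rees R N)) ∘ₗ
      (IsScalarTower.toAlgHom R (Rees R N) (FractionRing (Rees R N))).toLinearMap ∘ₗ
        reesι R N ∘ₗ μ
  refine ⟨reesLift hB f, fun y => ?_⟩
  rw [reesLift_reesι, Algebra.smul_def, ← hu]
  exact Units.mul_inv_cancel_left u _

theorem rees_to_fractionRing_comp {r : R} (hr : r ∈ nonZeroDivisors R) {f : N →ₗ[R] P}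
    {μ : P →ₗ[R] N} (hμ : ∀ e, μ (f e) = r • e) {g : Rees R P →ₐ[R] FractionRing (Rees R N)}
    (hg : ∀ y, r • g (reesι R P y) = algebraMap _ (FractionRing (Rees R N)) (reesι R N (μ y)))
    (x : Rees R N) : g (reesMap f x) = algebraMap _ _ x := by
  suffices h : g.comp (reesMap f) =
      IsScalarTower.toAlgHom R (Rees R N) (FractionRing (Rees R N)) from
    DFunLike.congr_fun h x
  refine rees_algHom_ext fun y => ?_
  have h1 := hg (f y)
  rw [hμ, map_smul] at h1
  have h2 : r • g (reesι R P (f y)) = r • algebraMap _ (FractionRing (Rees R N)) (reesι R N y) := by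
    rw [h1]
    exact map_smul (IsScalarTower.toAlgHom R (Rees R N) (FractionRing (Rees R N))) r _
  rw [Algebra.smul_def, Algebra.smul_def] at h2
  rw [AlgHom.comp_apply, reesMap_reesι]
  exact (isUnit_algebraMap_fractionRing_rees hr).mul_left_cancel h2

/-- If a multiple `r P` is mapped to `N`, compatibly with `f : N → P`, then the Rees algebra of `N`
is embedded in that of `P`: the map to `P` followed by division by `r` is the inclusion of the Rees
algebra of `N` in its ring of fractions. -/
theorem reesMap_injective {r : R} (hr : r ∈ nonZeroDivisors R) {f : N →ₗ[R] P} {μ : P →ₗ[R] N}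
    (hμ : ∀ e, μ (f e) = r • e) : Function.Injective (reesMap f) := by
  obtain ⟨g, hg⟩ := exists_rees_to_fractionRing hr μ
  have h : (fun x => g (reesMap f x)) = algebraMap (Rees R N) (FractionRing (Rees R N)) :=
    funext fun x => rees_to_fractionRing_comp hr hμ hg x
  have hinj := IsFractionRing.injective (Rees R N) (FractionRing (Rees R N))
  rw [← h] at hinj
  exact Function.Injective.of_comp hinj

theorem mvPolynomial_eq_zero_of_smul_eq_zero [IsDomain R] {ι : Type*} (r : R)
    (hr : r ∈ nonZeroDivisors R) (p : MvPolynomial ι R) (h : r • p = 0) : p = 0 :=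
  (smul_eq_zero.1 h).resolve_left (nonZeroDivisors.ne_zero hr)

/-- The Rees algebra of a free module over a domain is a polynomial ring. -/
noncomputable def reesEquivMvPolynomial [IsDomain R] {ι : Type*} (b : Module.Basis ι R N) :
    Rees R N ≃ₐ[R] MvPolynomial ι R :=
  AlgEquiv.ofAlgHom
    (reesLift mvPolynomial_eq_zero_of_smul_eq_zero
      (b.constr R fun i => (X i : MvPolynomial ι R)))
    (aeval fun i => reesι R N (b i))
    (MvPolynomial.algHom_ext fun i => by
      rw [AlgHom.comp_apply, aeval_X, reesLift_reesι, Module.Basis.constr_basis, AlgHom.id_apply])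
    (rees_algHom_ext fun y => by
      rw [AlgHom.comp_apply, reesLift_reesι, AlgHom.id_apply]
      suffices h : (aeval fun i => reesι R N (b i)).toLinearMap ∘ₗ
          (b.constr R fun i => (X i : MvPolynomial ι R)) = reesι R N from LinearMap.congr_fun h y
      refine b.ext fun i => ?_
      simp)

theorem reesEquivMvPolynomial_basis [IsDomain R] {ι : Type*} (b : Module.Basis ι R N) (i : ι) :
    reesEquivMvPolynomial b (reesι R N (b i)) = X i :=
  (reesLift_reesι mvPolynomial_eq_zero_of_smul_eq_zero _ _).trans
    (Module.Basis.constr_basis _ _ _ _)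

end ReesGeneral

/-! ### Graded pieces of the Rees algebras -/

section PolynomialSplitting

variable {k : Type*} [Field k]

/-- Forms of degree `a + b` are sums of products of forms of degrees `a` and `b`. -/
theorem polyDeg_add_induction {a b : ℕ} {motive : Poly2 k → Prop}
    (hadd : ∀ p q, motive p → motive q → motive (p + q)) (hzero : motive 0)
    (hmul : ∀ p ∈ polyDeg k a, ∀ q ∈ polyDeg k b, motive (p * q)) {p : Poly2 k}
    (hp : p ∈ polyDeg k (a + b)) : motive p := by
  obtain ⟨c, rfl⟩ := exists_eq_sum_monomials (c := a + b) (by exact_mod_cast hp)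
  refine Finset.sum_induction _ motive hadd hzero fun j _ => ?_
  rcases le_or_gt a j with h | h
  · obtain ⟨e, he⟩ := Nat.exists_eq_add_of_le h
    have h1 := mul_mem_polyDeg (X_pow_mem_polyDeg (k := k) 0 e) (X_pow_mem_polyDeg 1 (a + b - j))
    rw [show (e : ℤ) + (a + b - j : ℕ) = b by have := j.2; omega] at h1
    have := hmul _ (C_mul_mem_polyDeg (c j) (X_pow_mem_polyDeg 0 a)) _ h1
    rwa [show (C (c j) * X 0 ^ a : Poly2 k) * (X 0 ^ e * X 1 ^ (a + b - j))
      = C (c j) * (X 0 ^ (j : ℕ) * X 1 ^ (a + b - j)) by rw [he, pow_add]; ring] at this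
  · have h1 := mul_mem_polyDeg (X_pow_mem_polyDeg (k := k) 0 j) (X_pow_mem_polyDeg 1 (a - j))
    rw [show ((j : ℕ) : ℤ) + (a - j : ℕ) = a by omega] at h1
    have := hmul _ (C_mul_mem_polyDeg (c j) h1) _ (X_pow_mem_polyDeg 1 b)
    rwa [show (C (c j) * (X 0 ^ (j : ℕ) * X 1 ^ (a - j)) : Poly2 k) * X 1 ^ b
      = C (c j) * (X 0 ^ (j : ℕ) * X 1 ^ (a + b - j)) by
        rw [show a + b - j = a - j + b by omega, pow_add]; ring] at this

end PolynomialSplitting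

section GradedPieces

variable {k : Type*} [Field k] {N : Type*} [AddCommGroup N] [Module (Poly2 k) N]
  {B : Type*} [CommRing B] [Algebra (Poly2 k) B] (g : N →ₗ[Poly2 k] B) (deg : ℤ → AddSubgroup N)

/-- The additive group generated by the products `p * g y₁ ⋯ g y_j` with `p` a form and `y₁, …, y_j`
homogeneous, of total degree `i`. For the canonical map to the Rees algebra it is `reesDeg`. -/
def bidegPart (i : ℤ) (j : ℕ) : AddSubgroup B :=
  AddSubgroup.closure {z | ∃ (a : ℤ) (p : Poly2 k) (b : Fin j → ℤ) (y : Fin j → N),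
    p ∈ polyDeg k a ∧ (∀ l, y l ∈ deg (b l)) ∧ a + ∑ l, b l = i ∧ z = p • ∏ l, g (y l)}

/-- The sum of the groups `bidegPart g deg i j` with `i ≥ c`. -/
def bidegPartGE (c : ℤ) : AddSubgroup B :=
  ⨆ (i : ℤ) (_ : c ≤ i) (j : ℕ), bidegPart g deg i j

variable (k B) in
/-- The additive group of the images of the forms of degree `i`. -/
noncomputable def formPart (i : ℤ) : Submodule ℤ B :=
  ((polyDeg k i).map (algebraMap (Poly2 k) B).toAddMonoidHom).toIntSubmodule

/-- The image of the component of degree `b`. -/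
noncomputable def degImage (b : ℤ) : Submodule ℤ B :=
  ((deg b).map g.toAddMonoidHom).toIntSubmodule

variable {g deg}

theorem mem_formPart {i : ℤ} {z : B} :
    z ∈ formPart k B i ↔ ∃ p ∈ polyDeg k i, algebraMap (Poly2 k) B p = z := Iff.rfl

theorem mem_degImage {b : ℤ} {z : B} : z ∈ degImage g deg b ↔ ∃ y ∈ deg b, g y = z := Iff.rfl

theorem algebraMap_mem_bidegPart {i : ℤ} {p : Poly2 k} (hp : p ∈ polyDeg k i) :
    algebraMap (Poly2 k) B p ∈ bidegPart g deg i 0 :=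
  AddSubgroup.subset_closure ⟨i, p, Fin.elim0, Fin.elim0, hp, fun l => l.elim0, by simp,
    by simp [Algebra.algebraMap_eq_smul_one]⟩

theorem mul_mem_bidegPart {i b : ℤ} {j : ℕ} {z : B} {y : N} (hz : z ∈ bidegPart g deg i j)
    (hy : y ∈ deg b) : z * g y ∈ bidegPart g deg (i + b) (j + 1) := by
  induction hz using AddSubgroup.closure_induction with
  | mem z hz =>
    obtain ⟨a, p, c, w, hp, hw, rfl, rfl⟩ := hz
    refine AddSubgroup.subset_closure ⟨a, p, Fin.snoc c b, Fin.snoc w y, hp, fun l => ?_, ?_, ?_⟩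
    · refine Fin.lastCases ?_ (fun l => ?_) l
      · simpa using hy
      · simpa using hw l
    · simp [Fin.sum_univ_castSucc, add_assoc]
    · simp [Fin.prod_univ_castSucc]
  | zero =>
    rw [zero_mul]
    exact zero_mem _
  | add _ _ _ _ h h' =>
    rw [add_mul]
    exact add_mem h h'
  | neg _ _ h =>
    rw [neg_mul]
    exact neg_mem h

theorem bidegPart_le_bidegPartGE {c i : ℤ} (hi : c ≤ i) (j : ℕ) :
    bidegPart g deg i j ≤ bidegPartGE g deg c :=
  le_iSup_of_le i (le_iSup_of_le hi (le_iSup_of_le j le_rfl))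

theorem formPart_mul_pow_le (i : ℤ) (j : ℕ) :
    formPart k B i * degImage g deg 0 ^ j ≤ (bidegPart g deg i j).toIntSubmodule := by
  induction j with
  | zero =>
    rw [pow_zero, mul_one]
    rintro _ ⟨p, hp, rfl⟩
    exact algebraMap_mem_bidegPart hp
  | succ j ih =>
    rw [pow_succ, ← mul_assoc]
    refine (mul_le_mul_left ih _).trans (Submodule.mul_le.2 ?_)
    rintro z hz _ ⟨y, hy, rfl⟩
    have := mul_mem_bidegPart hz hy
    rwa [add_zero] at this

theorem map_bidegPart {B' : Type*} [CommRing B'] [Algebra (Poly2 k) B'] (h : B →ₐ[Poly2 k] B')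
    {g' : N →ₗ[Poly2 k] B'} (hg : ∀ y, h (g y) = g' y) (i : ℤ) (j : ℕ) :
    (bidegPart g deg i j).map h.toRingHom.toAddMonoidHom = bidegPart g' deg i j := by
  rw [bidegPart, AddMonoidHom.map_closure]
  congr 1
  ext z
  constructor
  · rintro ⟨_, ⟨a, p, b, y, hp, hy, hi, rfl⟩, rfl⟩
    refine ⟨a, p, b, y, hp, hy, hi, ?_⟩
    change h (p • ∏ l, g (y l)) = _
    simp [hg]
  · rintro ⟨a, p, b, y, hp, hy, hi, rfl⟩
    refine ⟨_, ⟨a, p, b, y, hp, hy, hi, rfl⟩, ?_⟩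
    change h (p • ∏ l, g (y l)) = _
    simp [hg]

theorem exists_mem_bidegPartGE_iff {B' : Type*} [CommRing B'] [Algebra (Poly2 k) B']
    (h : B →ₐ[Poly2 k] B') {g' : N →ₗ[Poly2 k] B'} (hg : ∀ y, h (g y) = g' y) (c : ℤ) (z : B') :
    (∃ x ∈ bidegPartGE g deg c, h x = z) ↔ z ∈ bidegPartGE g' deg c := by
  have : (bidegPartGE g deg c).map h.toRingHom.toAddMonoidHom = bidegPartGE g' deg c := by
    simp only [bidegPartGE, AddSubgroup.map_iSup, map_bidegPart h hg]
  rw [← this]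
  rfl

theorem bidegPart_comp_le {P : Type*} [AddCommGroup P] [Module (Poly2 k) P]
    {deg' : ℤ → AddSubgroup P} {f : P →ₗ[Poly2 k] N} (hf : ∀ i, ∀ y ∈ deg' i, f y ∈ deg i)
    (i : ℤ) (j : ℕ) : bidegPart (g ∘ₗ f) deg' i j ≤ bidegPart g deg i j := by
  refine AddSubgroup.closure_mono ?_
  rintro _ ⟨a, p, b, y, hp, hy, hi, rfl⟩
  exact ⟨a, p, b, fun l => f (y l), hp, fun l => hf _ _ (hy l), hi, rfl⟩

theorem bidegPartGE_comp_le {P : Type*} [AddCommGroup P] [Module (Poly2 k) P]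
    {deg' : ℤ → AddSubgroup P} {f : P →ₗ[Poly2 k] N} (hf : ∀ i, ∀ y ∈ deg' i, f y ∈ deg i)
    (c : ℤ) : bidegPartGE (g ∘ₗ f) deg' c ≤ bidegPartGE g deg c :=
  iSup_mono fun i => iSup_mono fun _ => iSup_mono fun j => bidegPart_comp_le hf i j

theorem mem_map_reesGE {P : Type*} [AddCommGroup P] [Module (Poly2 k) P] (f : N →ₗ[Poly2 k] P)
    (c : ℤ) (z : Rees (Poly2 k) P) :
    z ∈ (reesGE deg c).map (reesMap f).toRingHom.toAddMonoidHom ↔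
      z ∈ bidegPartGE (B := Rees (Poly2 k) P) (reesι (Poly2 k) P ∘ₗ f) deg c := by
  have := exists_mem_bidegPartGE_iff (B := Rees (Poly2 k) N) (B' := Rees (Poly2 k) P) (deg := deg)
    (g := reesι (Poly2 k) N) (g' := reesι (Poly2 k) P ∘ₗ f) (reesMap f) (reesMap_reesι f) c z
  exact this

end GradedPieces

section CokerGradedPieces

variable {k : Type*} [Field k] {n m : ℕ} {A : Matrix (Fin n) (Fin m) (Poly2 k)}
  {s : ℕ} {a : Fin s → ℕ}
  {b : Module.Basis (Fin s) (Poly2 k) (Module.Dual (Poly2 k) (ModE A))}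
  {B : Type*} [CommRing B] [Algebra (Poly2 k) B] {g : ModF A →ₗ[Poly2 k] B}

theorem eq_sum_dualBasis (b : Module.Basis (Fin s) (Poly2 k) (Module.Dual (Poly2 k) (ModE A)))
    (u : ModF A) : u = ∑ t, u (b t) • b.dualBasis t := by
  conv_lhs => rw [← b.dualBasis.sum_repr u]
  simp [Module.Basis.dualBasis_repr]

theorem smul_dualBasis_mem_degF (hb : ∀ t, b t ∈ dualDeg (degE A) (a t)) {i : ℤ} {p : Poly2 k}
    {t : Fin s} (hp : p ∈ polyDeg k (i + a t)) : p • b.dualBasis t ∈ degF A i := by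
  rw [mem_degF_iff hb]
  intro t'
  rw [LinearMap.smul_apply, Module.Basis.dualBasis_apply_self]
  split_ifs with h
  · subst h
    simpa using hp
  · simp [zero_mem]

theorem span_degF_zero (hb : ∀ t, b t ∈ dualDeg (degE A) (a t)) :
    Submodule.span (Poly2 k) (degF A 0 : Set (ModF A)) = subM A := by
  refine le_antisymm (Submodule.span_mono fun u hu => ⟨0, le_rfl, hu⟩) (Submodule.span_le.2 ?_)
  rintro u ⟨i, hi, hu⟩
  lift i to ℕ using hi
  rw [eq_sum_dualBasis b u]
  refine sum_mem fun t _ => ?_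
  refine polyDeg_add_induction
    (motive := fun p => p • b.dualBasis t ∈ Submodule.span (Poly2 k) (degF A 0 : Set (ModF A)))
    (fun p q hp hq => ?_) ?_ (fun p _ q hq => ?_) ((mem_degF_iff hb).1 hu t)
  · rw [add_smul]
    exact add_mem hp hq
  · rw [zero_smul]
    exact zero_mem _
  · rw [mul_smul]
    refine Submodule.smul_mem _ _ (Submodule.subset_span (smul_dualBasis_mem_degF hb ?_))
    rwa [zero_add]

theorem smul_prod_dualBasis_mem (hb : ∀ t, b t ∈ dualDeg (degE A) (a t)) (i j : ℕ)
    (τ : Fin j → Fin s) {p : Poly2 k} (hp : p ∈ polyDeg k ((i + ∑ l, a (τ l) : ℕ))) :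
    p • ∏ l, g (b.dualBasis (τ l)) ∈ formPart k B i * degImage g (degF A) 0 ^ j := by
  induction j generalizing p with
  | zero =>
    rw [pow_zero, mul_one, mem_formPart]
    simp only [Finset.univ_eq_empty, Finset.sum_empty, add_zero] at hp
    exact ⟨p, hp, by simp [Algebra.algebraMap_eq_smul_one]⟩
  | succ j ih =>
    have hp' : p ∈ polyDeg k ((i + ∑ l : Fin j, a (τ l.succ) : ℕ) + (a (τ 0) : ℕ)) := by
      rw [Fin.sum_univ_succ] at hp
      rwa [show (((i + (a (τ 0) + ∑ l : Fin j, a (τ l.succ)) : ℕ)) : ℤ) =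
        (i + ∑ l : Fin j, a (τ l.succ) : ℕ) + (a (τ 0) : ℕ) by push_cast; ring] at hp
    refine polyDeg_add_induction (motive := fun p =>
      p • ∏ l, g (b.dualBasis (τ l)) ∈ formPart k B i * degImage g (degF A) 0 ^ (j + 1))
      (fun p q hp hq => ?_) ?_ (fun p hp q hq => ?_) hp'
    · rw [add_smul]
      exact add_mem hp hq
    · rw [zero_smul]
      exact zero_mem _
    · have h2 : g (q • b.dualBasis (τ 0)) ∈ degImage g (degF A) 0 :=
        ⟨_, smul_dualBasis_mem_degF hb (by rwa [zero_add]), rfl⟩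
      have h3 := Submodule.mul_mem_mul (ih (fun l => τ l.succ) hp) h2
      rw [mul_assoc, ← pow_succ] at h3
      rwa [Fin.prod_univ_succ, mul_comm (g _), ← smul_mul_smul_comm, ← map_smul]

/-- The component of bidegree `(i, j)` of the Rees algebra of `F` is `R_i F_0 ^ j` if `i ≥ 0`: in
`p * e_{t₁} ⋯ e_{t_j}`, the form `p` is split into factors that raise the degree of each of the
basis elements to zero, and a factor of degree `i`. -/
theorem bidegPart_degF_le (hb : ∀ t, b t ∈ dualDeg (degE A) (a t)) (i j : ℕ) :
    (bidegPart g (degF A) i j).toIntSubmodule ≤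
      formPart k B i * degImage g (degF A) 0 ^ j := by
  intro z hz
  refine (AddSubgroup.closure_le (K := (formPart k B i *
    degImage g (degF A) 0 ^ j).toAddSubgroup)).2 ?_ hz
  rintro _ ⟨d, p, c, y, hp, hy, hi, rfl⟩
  have h1 : ∀ l, g (y l) = ∑ t, y l (b t) • g (b.dualBasis t) := by
    intro l
    conv_lhs => rw [eq_sum_dualBasis b (y l), map_sum]
    exact Finset.sum_congr rfl fun t _ => map_smul _ _ _
  rw [Finset.prod_congr rfl fun l _ => h1 l, Finset.prod_univ_sum, Finset.smul_sum]
  refine sum_mem fun τ _ => ?_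
  rw [Finset.prod_smul, smul_smul]
  refine smul_prod_dualBasis_mem hb i j τ ?_
  have h2 : ∏ l, y l (b (τ l)) ∈ polyDeg k (∑ l, (c l + a (τ l))) :=
    IsWeightedHomogeneous.prod _ _ _ fun l _ => (mem_degF_iff hb).1 (hy l) (τ l)
  have h3 := mul_mem_polyDeg hp h2
  rwa [Finset.sum_add_distrib, ← add_assoc, hi, ← Nat.cast_sum, ← Nat.cast_add] at h3

theorem degImage_comp_inclM_zero :
    degImage (g ∘ₗ inclM A) (degM A) 0 = degImage g (degF A) 0 := by
  ext z
  rw [mem_degImage, mem_degImage]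
  constructor
  · rintro ⟨y, hy, rfl⟩
    exact ⟨y, hy, rfl⟩
  · rintro ⟨y, hy, rfl⟩
    exact ⟨⟨y, Submodule.subset_span ⟨0, le_rfl, hy⟩⟩, hy, rfl⟩

/-- The products of nonnegative degree of forms and elements of `F` are sums of such products
with elements of `M`. -/
theorem bidegPart_degF_le_degM (hb : ∀ t, b t ∈ dualDeg (degE A) (a t)) (i j : ℕ) :
    bidegPart g (degF A) i j ≤ bidegPart (g ∘ₗ inclM A) (degM A) i j := by
  refine fun z hz => formPart_mul_pow_le i j ?_
  rw [degImage_comp_inclM_zero]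
  exact bidegPart_degF_le hb i j hz

theorem single_mem_degE (A : Matrix (Fin n) (Fin m) (Poly2 k)) (l : Fin n) :
    mkE A (Pi.single l 1) ∈ degE A 0 := by
  refine (mem_degE_iff A).2 ⟨_, fun t => ?_, rfl⟩
  by_cases htl : t = l
  · subst htl
    simpa using C_mem_polyDeg (1 : k)
  · simp [htl, zero_mem]

/-- In degrees in which `E` and `F` agree, products of forms with elements of degree zero of `F` are
sums of products with elements of degree zero of `E`. -/
theorem formPart_mul_degImage_le {i : ℤ}
    (hEF : ∀ u ∈ degF A i, ∃ v, IsHomVec i v ∧ toF A (mkE A v) = u)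
    (hb : ∀ t, b t ∈ dualDeg (degE A) (a t)) :
    formPart k B i * degImage g (degF A) 0 ≤
      formPart k B i * degImage (g ∘ₗ toF A) (degE A) 0 := by
  refine Submodule.mul_le.2 ?_
  rintro _ ⟨p, hp, rfl⟩ _ ⟨y, hy, rfl⟩
  have hpy : p • y ∈ degF A i := by
    rw [mem_degF_iff hb]
    intro t
    have := mul_mem_polyDeg hp ((mem_degF_iff hb).1 hy t)
    rwa [zero_add] at this
  obtain ⟨v, hv, hvy⟩ := hEF _ hpy
  have h1 : algebraMap (Poly2 k) B p * g y =
      ∑ l, algebraMap (Poly2 k) B (v l) * g (toF A (mkE A (Pi.single l 1))) := by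
    rw [← Algebra.smul_def, ← map_smul, ← hvy]
    conv_lhs => rw [pi_eq_sum_univ' v]
    simp only [map_sum, map_smul]
    exact Finset.sum_congr rfl fun l _ => Algebra.smul_def _ _
  change algebraMap (Poly2 k) B p * g y ∈ _
  rw [h1]
  exact sum_mem fun l _ => Submodule.mul_mem_mul ⟨_, hv l, rfl⟩ ⟨_, single_mem_degE A l, rfl⟩

/-- In degrees in which `E` and `F` agree, one factor after the other can be moved from `F_0` to
`E_0`. -/
theorem bidegPart_degF_le_degE {i : ℕ}
    (hEF : ∀ u ∈ degF A i, ∃ v, IsHomVec i v ∧ toF A (mkE A v) = u)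
    (hb : ∀ t, b t ∈ dualDeg (degE A) (a t)) (j : ℕ) :
    bidegPart g (degF A) i j ≤ bidegPart (g ∘ₗ toF A) (degE A) i j := by
  have h1 := formPart_mul_degImage_le (g := g) hEF hb
  have h2 : ∀ j : ℕ, formPart k B i * degImage g (degF A) 0 ^ j ≤
      formPart k B i * degImage (g ∘ₗ toF A) (degE A) 0 ^ j := by
    intro j
    induction j with
    | zero => rw [pow_zero, pow_zero]
    | succ j ih =>
      rw [pow_succ', pow_succ, ← mul_assoc, ← mul_assoc]
      refine (mul_le_mul_left h1 _).trans ?_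
      rw [mul_right_comm]
      exact mul_le_mul_left ih _
  exact fun z hz => formPart_mul_pow_le i j (h2 j (bidegPart_degF_le hb i j hz))

theorem bidegPartGE_degE_eq_degF {c : ℤ} (hc : 0 ≤ c)
    (hEF : ∀ i, c ≤ i → ∀ u ∈ degF A i, ∃ v, IsHomVec i v ∧ toF A (mkE A v) = u)
    (hb : ∀ t, b t ∈ dualDeg (degE A) (a t)) :
    bidegPartGE (g ∘ₗ toF A) (degE A) c = bidegPartGE g (degF A) c := by
  refine le_antisymm (bidegPartGE_comp_le (fun i y hy => toF_mem_degF A hy) c) ?_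
  refine iSup_le fun i => iSup_le fun hi => iSup_le fun j => ?_
  lift i to ℕ using hc.trans hi
  exact (bidegPart_degF_le_degE (hEF i hi) hb j).trans (bidegPart_le_bidegPartGE hi j)

theorem bidegPartGE_degM_eq_degF {c : ℤ} (hc : 0 ≤ c)
    (hb : ∀ t, b t ∈ dualDeg (degE A) (a t)) :
    bidegPartGE (g ∘ₗ inclM A) (degM A) c = bidegPartGE g (degF A) c := by
  refine le_antisymm (bidegPartGE_comp_le (fun i y hy => hy) c) ?_
  refine iSup_le fun i => iSup_le fun hi => iSup_le fun j => ?_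
  lift i to ℕ using hc.trans hi
  exact (bidegPart_degF_le_degM hb i j).trans (bidegPart_le_bidegPartGE hi j)

theorem mem_reesGE_degF_iff (A : Matrix (Fin n) (Fin m) (Poly2 k)) (c : ℤ)
    (z : Rees (Poly2 k) (ModF A)) : z ∈ reesGE (degF A) c ↔
      z ∈ bidegPartGE (B := Rees (Poly2 k) (ModF A)) (reesι (Poly2 k) (ModF A)) (degF A) c :=
  Iff.rfl

theorem map_reesGE_degE {c : ℤ} (hc : 0 ≤ c)
    (hEF : ∀ i, c ≤ i → ∀ u ∈ degF A i, ∃ v, IsHomVec i v ∧ toF A (mkE A v) = u)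
    (hb : ∀ t, b t ∈ dualDeg (degE A) (a t)) :
    (reesGE (degE A) c).map (reesEF A).toRingHom.toAddMonoidHom = reesGE (degF A) c := by
  ext z
  have h := bidegPartGE_degE_eq_degF (B := Rees (Poly2 k) (ModF A))
    (g := reesι (Poly2 k) (ModF A)) hc hEF hb
  have h1 := mem_map_reesGE (N := ModE A) (P := ModF A) (deg := degE A) (toF A) c z
  have h2 := SetLike.ext_iff.1 h z
  have h3 := mem_reesGE_degF_iff A c z
  exact h1.trans (h2.trans h3.symm)

theorem map_reesGE_degM {c : ℤ} (hc : 0 ≤ c)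
    (hb : ∀ t, b t ∈ dualDeg (degE A) (a t)) :
    (reesGE (degM A) c).map (reesMF A).toRingHom.toAddMonoidHom = reesGE (degF A) c := by
  ext z
  have h := bidegPartGE_degM_eq_degF (B := Rees (Poly2 k) (ModF A))
    (g := reesι (Poly2 k) (ModF A)) hc hb
  have h1 := mem_map_reesGE (N := subM A) (P := ModF A) (deg := degM A) (inclM A) c z
  have h2 := SetLike.ext_iff.1 h z
  have h3 := mem_reesGE_degF_iff A c z
  exact h1.trans (h2.trans h3.symm)

end CokerGradedPieces

/-! ### The determinant trick and reductions -/

section DeterminantTrick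

variable {R B : Type*} [CommRing R] [CommRing B] [Algebra R B]

theorem prod_mem_pow_card {ι : Type*} {L : Submodule R B} (s : Finset ι) {x : ι → B}
    (hx : ∀ i, x i ∈ L) : ∏ i ∈ s, x i ∈ L ^ s.card := by
  classical
  induction s using Finset.induction_on with
  | empty =>
    rw [Finset.prod_empty, Finset.card_empty, pow_zero]
    exact Submodule.one_le.1 le_rfl
  | insert i s hi ih =>
    rw [Finset.prod_insert hi, Finset.card_insert_of_notMem hi, pow_succ']
    exact Submodule.mul_mem_mul (hx i) ih

theorem prod_add_sub_prod_mem {ι : Type*} {U L : Submodule R B} (hUL : U ≤ L) (s : Finset ι)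
    {x z : ι → B} (hx : ∀ i, x i ∈ L) (hz : ∀ i, z i ∈ U) :
    ∏ i ∈ s, (x i + z i) - ∏ i ∈ s, x i ∈ U * L ^ (s.card - 1) := by
  classical
  induction s using Finset.induction_on with
  | empty => simp
  | insert i s hi ih =>
    have h1 := Submodule.mul_mem_mul (hz i)
      (prod_mem_pow_card s (fun i => add_mem (hx i) (hUL (hz i))))
    have h2 : x i * (∏ i ∈ s, (x i + z i) - ∏ i ∈ s, x i) ∈ U * L ^ s.card := by
      rcases s.eq_empty_or_nonempty with rfl | hs
      · simp
      · have := Submodule.mul_mem_mul (hx i) ih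
        rwa [mul_left_comm, ← pow_succ', Nat.sub_add_cancel hs.card_pos] at this
    rw [Finset.prod_insert hi, Finset.prod_insert hi, Finset.card_insert_of_notMem hi,
      Nat.add_sub_cancel]
    convert add_mem h1 h2 using 1
    ring

/-- The determinant trick: if multiplication by `y` maps the entries of a nonzero vector `v` to
combinations of these entries with coefficients in `U`, then a power of `y` lies in
`U * L ^ (c - 1)`: expand the determinant of `y - P`, which annihilates `v`. -/
theorem pow_card_mem_of_mulVec_eq [IsDomain B] {ι : Type*} [Fintype ι] [DecidableEq ι]
    {U L : Submodule R B} (hUL : U ≤ L) {y : B} (hy : y ∈ L) {v : ι → B} (hv : v ≠ 0)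
    {P : Matrix ι ι B} (hP : ∀ i j, P i j ∈ U) (h : P.mulVec v = y • v) :
    y ^ Fintype.card ι ∈ U * L ^ (Fintype.card ι - 1) := by
  have hdet : (y • (1 : Matrix ι ι B) + -P).det = 0 := by
    rw [← Matrix.exists_mulVec_eq_zero_iff]
    refine ⟨v, hv, ?_⟩
    rw [Matrix.add_mulVec, Matrix.neg_mulVec, h, Matrix.smul_mulVec, Matrix.one_mulVec,
      add_neg_cancel]
  have hone : (y • (1 : Matrix ι ι B)).det = y ^ Fintype.card ι := by
    rw [Matrix.det_smul, Matrix.det_one, mul_one]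
  rw [← hone, ← neg_mem_iff, ← zero_sub, ← hdet, Matrix.det_apply, Matrix.det_apply,
    ← Finset.sum_sub_distrib]
  refine sum_mem fun σ _ => ?_
  rw [← smul_sub]
  have := prod_add_sub_prod_mem hUL (Finset.univ : Finset ι)
    (x := fun i => (y • (1 : Matrix ι ι B)) (σ i) i) (z := fun i => (-P) (σ i) i) (fun i => ?_)
    (fun i => neg_mem (hP _ _))
  · rcases Int.units_eq_one_or (Equiv.Perm.sign σ) with hs | hs
    · rw [hs, one_smul]
      exact this
    · rw [hs, Units.neg_smul, one_smul]
      exact neg_mem this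
  · rw [Matrix.smul_apply, Matrix.one_apply]
    split_ifs
    · simpa using hy
    · simp

/-- If multiplication by `y` acts on the entries of a nonzero vector by a matrix with entries in
`S`, then `y` is integral over `S`. -/
theorem isIntegralElem_of_mulVec_eq [IsDomain B] {S : Type*} [CommRing S] (f : S →+* B)
    {ι : Type*} [Fintype ι] {y : B} {v : ι → B} (hv : v ≠ 0) {P : Matrix ι ι S}
    (h : ∀ i, y * v i = ∑ j, f (P i j) * v j) : f.IsIntegralElem y := by
  algebraize [f]
  refine isIntegral_of_smul_mem_submodule (Submodule.span S (Set.range v)) ?_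
    ⟨(Set.finite_range v).toFinset, by simp⟩ y fun x hx => ?_
  · rw [Ne, Submodule.span_eq_bot]
    intro h0
    exact hv (funext fun i => h0 _ ⟨i, rfl⟩)
  · induction hx using Submodule.span_induction with
    | mem x hx =>
      obtain ⟨i, rfl⟩ := hx
      rw [smul_eq_mul, h]
      refine sum_mem fun j _ => ?_
      exact Submodule.smul_mem (Submodule.span S (Set.range v)) (P i j)
        (Submodule.subset_span ⟨j, rfl⟩)
    | zero => rw [smul_zero]; exact zero_mem _
    | add x z _ _ hx hz => rw [smul_add]; exact add_mem hx hz
    | smul r x _ hx => rw [smul_comm]; exact Submodule.smul_mem _ _ hx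

/-- The sum of two submodules satisfying equations of integral dependence on `U` satisfies one: in
`(X + Y) ^ (a + b + 1)`, each product has `a + 1` factors from `X` or `b + 1` factors from `Y`. -/
theorem sup_pow_succ_le {U L X Y : Submodule R B} (hX : X ≤ L) (hY : Y ≤ L) {a b : ℕ}
    (hXa : X ^ (a + 1) ≤ U * L ^ a) (hYb : Y ^ (b + 1) ≤ U * L ^ b) :
    (X ⊔ Y) ^ (a + b + 1) ≤ U * L ^ (a + b) := by
  have h1 : ∀ {Z W : Submodule R B} {c p q : ℕ}, Z ≤ L → W ≤ L → Z ^ (c + 1) ≤ U * L ^ c →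
      c + 1 ≤ p → p + q = a + b + 1 → Z ^ p * W ^ q ≤ U * L ^ (a + b) := by
    intro Z W c p q hZ hW hc hp hpq
    obtain ⟨e, rfl⟩ := Nat.exists_eq_add_of_le hp
    rw [pow_add Z (c + 1), show a + b = c + e + q by omega, pow_add L (c + e), pow_add L c,
      ← mul_assoc, ← mul_assoc]
    exact mul_le_mul' (mul_le_mul' hc (pow_le_pow_left' hZ e)) (pow_le_pow_left' hW q)
  rw [← Submodule.add_eq_sup, add_pow]
  refine Finset.sum_induction _ (fun Z => Z ≤ U * L ^ (a + b)) (fun Z W hZ hW => sup_le hZ hW)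
    bot_le fun i hi => ?_
  have hi' : i ≤ a + b + 1 := Nat.lt_succ_iff.1 (Finset.mem_range.1 hi)
  have h2 : X ^ i * Y ^ (a + b + 1 - i) ≤ U * L ^ (a + b) := by
    rcases le_or_gt (a + 1) i with h | h
    · exact h1 hX hY hXa h (by omega)
    · rw [mul_comm]
      exact h1 hY hX hYb (by omega) (by omega)
  rw [mul_comm, ← nsmul_eq_mul]
  generalize (a + b + 1).choose i = N
  induction N with
  | zero => rw [zero_smul]; exact bot_le
  | succ N ih => rw [succ_nsmul]; exact sup_le ih h2

/-- A finitely generated module `L ⊇ U` all of whose elements satisfy an equation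
`y ^ (r + 1) ∈ U * L ^ r` has `U` as a reduction. -/
theorem exists_pow_succ_eq_mul_pow {U L : Submodule R B} (hUL : U ≤ L) (hL : L.FG)
    (h : ∀ y ∈ L, ∃ r : ℕ, y ^ (r + 1) ∈ U * L ^ r) : ∃ r : ℕ, L ^ (r + 1) = U * L ^ r := by
  classical
  obtain ⟨T, hT⟩ := hL
  have key : ∀ T' ⊆ T, ∃ r : ℕ, Submodule.span R (T' : Set B) ^ (r + 1) ≤ U * L ^ r := by
    intro T'
    induction T' using Finset.induction_on with
    | empty =>
      refine fun _ => ⟨0, ?_⟩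
      rw [zero_add, pow_one, Finset.coe_empty, Submodule.span_empty]
      exact bot_le
    | insert y T' _ ih =>
      intro hsub
      obtain ⟨hy, hT'⟩ := Finset.insert_subset_iff.1 hsub
      have hle : ∀ T'' ⊆ T, Submodule.span R (T'' : Set B) ≤ L := fun T'' hT'' =>
        hT ▸ Submodule.span_mono (Finset.coe_subset.2 hT'')
      have hyL : y ∈ L := hT ▸ Submodule.subset_span hy
      obtain ⟨r, hr⟩ := h y hyL
      obtain ⟨r', hr'⟩ := ih hT'
      refine ⟨r + r', ?_⟩
      rw [Finset.coe_insert, Submodule.span_insert]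
      refine sup_pow_succ_le ?_ (hle T' hT') ?_ hr'
      · rwa [Submodule.span_singleton_le_iff_mem]
      · rwa [Submodule.span_pow, Set.singleton_pow, Submodule.span_singleton_le_iff_mem]
  obtain ⟨r, hr⟩ := key T subset_rfl
  rw [hT] at hr
  refine ⟨r, le_antisymm hr ?_⟩
  rw [pow_succ']
  exact mul_le_mul' hUL le_rfl

end DeterminantTrick

section Reduction

variable {k : Type*} [Field k] {n m : ℕ} {A : Matrix (Fin n) (Fin m) (Poly2 k)}
  {s : ℕ} {a : Fin s → ℕ}
  {b : Module.Basis (Fin s) (Poly2 k) (Module.Dual (Poly2 k) (ModE A))}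

/-- Multiplication by an element of `M` maps the forms of degree `c` to `R_c E`, if `E` and `F`
agree in degree `c`: the product of a form of degree `c` and an element of degree zero of `F` lies
in `F_c = E_c = R_c E_0`. -/
theorem exists_matrix_of_mem_subM {c : ℕ}
    (hEF : ∀ u ∈ degF A c, ∃ v, IsHomVec c v ∧ toF A (mkE A v) = u)
    (hb : ∀ t, b t ∈ dualDeg (degE A) (a t)) {y : ModF A} (hy : y ∈ subM A) :
    ∃ P : Fin (c + 1) → Fin (c + 1) → ModE A, ∀ i : Fin (c + 1),
      (X 0 ^ (i : ℕ) * X 1 ^ (c - i) : Poly2 k) • y =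
        ∑ j : Fin (c + 1), (X 0 ^ (j : ℕ) * X 1 ^ (c - j) : Poly2 k) • toF A (P i j) := by
  rw [← span_degF_zero hb] at hy
  induction hy using Submodule.span_induction with
  | mem y hy =>
    have h1 : ∀ i : Fin (c + 1), (X 0 ^ (i : ℕ) * X 1 ^ (c - i) : Poly2 k) • y ∈ degF A c := by
      intro i
      rw [mem_degF_iff hb]
      intro t
      have := mul_mem_polyDeg (monomial_mem_polyDeg i) ((mem_degF_iff hb).1 hy t)
      rwa [zero_add] at this
    choose v hv hvy using fun i => hEF _ (h1 i)
    choose κ hκ using fun i l => exists_eq_sum_monomials (hv i l)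
    refine ⟨fun i j => mkE A fun l => C (κ i l j), fun i => ?_⟩
    rw [← hvy]
    simp only [← map_smul, ← map_sum]
    congr 2
    funext l
    rw [hκ i l, Finset.sum_apply]
    exact Finset.sum_congr rfl fun j _ => mul_comm _ _
  | zero => exact ⟨fun _ _ => 0, fun i => by simp⟩
  | add y z _ _ hy hz =>
    obtain ⟨P, hP⟩ := hy
    obtain ⟨Q, hQ⟩ := hz
    exact ⟨P + Q, fun i => by
      simp only [smul_add, hP, hQ, Pi.add_apply, map_add, Finset.sum_add_distrib]⟩
  | smul r y _ hy =>
    obtain ⟨P, hP⟩ := hy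
    refine ⟨fun i j => r • P i j, fun i => ?_⟩
    rw [smul_comm, hP, Finset.smul_sum]
    exact Finset.sum_congr rfl fun j _ => by rw [map_smul, smul_comm]

variable {B : Type*} [CommRing B] [Algebra (Poly2 k) B] {g : ModF A →ₗ[Poly2 k] B}

theorem algebraMap_monomials_ne_zero (hB : Function.Injective (algebraMap (Poly2 k) B)) (c : ℕ) :
    (fun i : Fin (c + 1) => algebraMap (Poly2 k) B (X 0 ^ (i : ℕ) * X 1 ^ (c - i))) ≠ 0 := by
  intro h
  have h0 := congrFun h 0
  rw [Pi.zero_apply, map_eq_zero_iff _ hB] at h0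
  exact mul_ne_zero (pow_ne_zero _ (X_ne_zero 0)) (pow_ne_zero _ (X_ne_zero 1)) h0

theorem exists_map_subM_pow_succ_eq [IsDomain B]
    (hB : Function.Injective (algebraMap (Poly2 k) B)) {c : ℕ}
    (hEF : ∀ u ∈ degF A c, ∃ v, IsHomVec c v ∧ toF A (mkE A v) = u)
    (hb : ∀ t, b t ∈ dualDeg (degE A) (a t)) :
    ∃ r : ℕ, (subM A).map g ^ (r + 1) =
      (LinearMap.range (toF A)).map g * (subM A).map g ^ r := by
  have hle : LinearMap.range (toF A) ≤ subM A := by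
    rintro _ ⟨e, rfl⟩
    exact toF_mem_subM A e
  have : Module.Finite (Poly2 k) (ModF A) := Module.Finite.of_basis b.dualBasis
  refine exists_pow_succ_eq_mul_pow (Submodule.map_mono hle)
    ((IsNoetherian.noetherian (subM A)).map g) ?_
  rintro _ ⟨y, hy, rfl⟩
  obtain ⟨P, hP⟩ := exists_matrix_of_mem_subM hEF hb hy
  refine ⟨c, ?_⟩
  have := pow_card_mem_of_mulVec_eq (R := Poly2 k) (U := (LinearMap.range (toF A)).map g)
    (L := (subM A).map g) (Submodule.map_mono hle) (y := g y) ⟨y, hy, rfl⟩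
    (algebraMap_monomials_ne_zero hB c)
    (P := Matrix.of fun i j => g (toF A (P i j)))
    (fun i j => ⟨toF A (P i j), ⟨P i j, rfl⟩, rfl⟩) ?_
  · rwa [Fintype.card_fin, Nat.add_sub_cancel] at this
  · funext i
    have h1 := congrArg g (hP i)
    rw [map_smul, map_sum, Algebra.smul_def, mul_comm] at h1
    rw [Pi.smul_apply, smul_eq_mul, h1, Matrix.mulVec, dotProduct]
    refine Finset.sum_congr rfl fun j _ => ?_
    rw [map_smul, Algebra.smul_def, mul_comm, Matrix.of_apply]

/-- Elements of `M` are integral over each ring whose image contains that of `E`. -/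
theorem isIntegralElem_of_mem_subM [IsDomain B]
    (hB : Function.Injective (algebraMap (Poly2 k) B)) {c : ℕ}
    (hEF : ∀ u ∈ degF A c, ∃ v, IsHomVec c v ∧ toF A (mkE A v) = u)
    (hb : ∀ t, b t ∈ dualDeg (degE A) (a t)) {S : Type*} [CommRing S] (f : S →+* B)
    (h : ModE A → S) (hf : ∀ e, f (h e) = g (toF A e)) {y : ModF A} (hy : y ∈ subM A) :
    f.IsIntegralElem (g y) := by
  obtain ⟨P, hP⟩ := exists_matrix_of_mem_subM hEF hb hy
  refine isIntegralElem_of_mulVec_eq f (algebraMap_monomials_ne_zero hB c)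
    (P := Matrix.of fun i j => h (P i j)) fun i => ?_
  have h1 := congrArg g (hP i)
  rw [map_smul, map_sum, Algebra.smul_def, mul_comm] at h1
  rw [h1]
  refine Finset.sum_congr rfl fun j _ => ?_
  rw [map_smul, Algebra.smul_def, mul_comm, Matrix.of_apply, hf]

end Reduction

/-! ### Integral closure and elements of nonnegative degree -/

section FractionEmbedding

/-- If `RM ⊇ RE` consists of fractions of `RE`, is integral over `RE`, and contains all elements of
an integrally closed domain `S` that are integral over `RE`, then `RM` is the integral closure of
`RE` in its field of fractions. -/
theorem exists_integralClosure_embedding {RE RM S : Type*} [CommRing RE] [CommRing RM] [CommRing S]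
    [IsDomain S] [IsIntegrallyClosed S] (q : RE →+* RM) (h : RM →+* S)
    (hq : Function.Injective q) (hh : Function.Injective h)
    (hfrac : ∀ x, ∃ d e, d ≠ 0 ∧ q d * x = q e) (hint : ∀ x, q.IsIntegralElem x)
    (hclosed : ∀ w, (h.comp q).IsIntegralElem w → w ∈ h.range) :
    ∃ g : RM →+* FractionRing RE, Function.Injective g ∧
      (∀ x, g (q x) = algebraMap RE (FractionRing RE) x) ∧ ∀ z, IsIntegral RE z ↔ z ∈ g.range := by
  have hhq : Function.Injective (h.comp q) := hh.comp hq
  have : IsDomain RE := hhq.isDomain (h.comp q)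
  let K := FractionRing S
  have hle : nonZeroDivisors RE ≤ (nonZeroDivisors S).comap (h.comp q) :=
    nonZeroDivisors_le_comap_nonZeroDivisors_of_injective _ hhq
  let j : FractionRing RE →+* K := IsLocalization.map K (h.comp q) hle
  have hj : ∀ x, j (algebraMap RE _ x) = algebraMap S K (h (q x)) := fun x =>
    IsLocalization.map_eq _ _
  have hjinj : Function.Injective j :=
    IsLocalization.map_injective_of_injective' (Sₘ := K) (hf := hle)
    (hN := zero_notMem_nonZeroDivisors) (hf' := hhq)
  have hK := IsFractionRing.injective S K
  have hrange : ∀ x, (algebraMap S K).comp h x ∈ j.range := by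
    intro x
    obtain ⟨d, e, hd, hde⟩ := hfrac x
    let z : FractionRing RE := IsLocalization.mk' _ e ⟨d, mem_nonZeroDivisors_of_ne_zero hd⟩
    have hz : z * algebraMap RE _ d = algebraMap RE _ e := IsLocalization.mk'_spec _ e
      (⟨d, mem_nonZeroDivisors_of_ne_zero hd⟩ : nonZeroDivisors RE)
    refine ⟨z, ?_⟩
    have h1 := congrArg j hz
    rw [map_mul, hj, hj, ← hde, map_mul, map_mul, mul_comm] at h1
    refine mul_left_cancel₀ ?_ h1
    rw [Ne, map_eq_zero_iff _ hK, map_eq_zero_iff _ hh, map_eq_zero_iff _ hq]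
    exact hd
  let ej : FractionRing RE ≃+* j.range := RingEquiv.ofBijective j.rangeRestrict
    ⟨fun x y hxy => hjinj (congrArg Subtype.val hxy), j.rangeRestrict_surjective⟩
  let g : RM →+* FractionRing RE :=
    ej.symm.toRingHom.comp (((algebraMap S K).comp h).codRestrict j.range hrange)
  have hjg : ∀ x, j (g x) = algebraMap S K (h x) := fun x => by
    have := ej.apply_symm_apply (((algebraMap S K).comp h).codRestrict j.range hrange x)
    exact congrArg Subtype.val this
  have hgq : ∀ x, g (q x) = algebraMap RE (FractionRing RE) x := fun x => by
    apply hjinj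
    rw [hjg, hj]
  refine ⟨g, fun x y hxy => hh (hK ?_), hgq, fun z => ⟨?_, ?_⟩⟩
  · rw [← hjg, ← hjg, hxy]
  · rintro ⟨p, hp, hpz⟩
    have h1 : Polynomial.eval₂ ((algebraMap S K).comp (h.comp q)) (j z) p = 0 := by
      have h2 := congrArg j hpz
      rw [Polynomial.hom_eval₂, map_zero] at h2
      rwa [show (algebraMap S K).comp (h.comp q) = j.comp (algebraMap RE (FractionRing RE)) from
        RingHom.ext fun x => (hj x).symm]
    have h3 : IsIntegral S (j z) := by
      refine ⟨p.map (h.comp q), hp.map _, ?_⟩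
      rwa [Polynomial.eval₂_map]
    obtain ⟨w, hw⟩ := IsIntegrallyClosed.isIntegral_iff.1 h3
    have h4 : (h.comp q).IsIntegralElem w := by
      refine ⟨p, hp, hK ?_⟩
      rw [Polynomial.hom_eval₂, map_zero, hw]
      exact h1
    obtain ⟨x, rfl⟩ := hclosed w h4
    exact ⟨x, hjinj (by rw [hjg, hw])⟩
  · rintro ⟨x, rfl⟩
    obtain ⟨p, hp, hpx⟩ := hint x
    refine ⟨p, hp, ?_⟩
    have h2 := congrArg g hpx
    rw [Polynomial.hom_eval₂, map_zero] at h2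
    rwa [show algebraMap RE (FractionRing RE) = g.comp q from
      RingHom.ext fun x => (hgq x).symm]

open scoped LaurentPolynomial in
/-- Polynomials in `T` over a factorial domain are integrally closed in Laurent polynomials. -/
theorem exists_toLaurent_eq_of_isIntegral {S : Type*} [CommRing S] [IsDomain S]
    [UniqueFactorizationMonoid S] {z : S[T;T⁻¹]} (hz : IsIntegral (Polynomial S) z) :
    ∃ p, Polynomial.toLaurent p = z := by
  have hle : Submonoid.powers (Polynomial.X : Polynomial S) ≤
      (nonZeroDivisors (Polynomial S)).comap (RingHom.id _) :=
    powers_le_nonZeroDivisors_of_noZeroDivisors Polynomial.X_ne_zero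
  let K := FractionRing (Polynomial S)
  let j : S[T;T⁻¹] →+* K := IsLocalization.map K (RingHom.id (Polynomial S)) hle
  have hj : ∀ x, j (algebraMap (Polynomial S) _ x) = algebraMap (Polynomial S) K x := fun x =>
    IsLocalization.map_eq _ _
  have hjinj : Function.Injective j :=
    IsLocalization.map_injective_of_injective' (Sₘ := K) (hf := hle)
    (hN := zero_notMem_nonZeroDivisors)
    (hf' := Function.injective_id)
  obtain ⟨p, hp, hpz⟩ := hz
  have h1 : IsIntegral (Polynomial S) (j z) := by
    refine ⟨p, hp, ?_⟩
    have h2 := congrArg j hpz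
    rw [Polynomial.hom_eval₂, map_zero] at h2
    rwa [show algebraMap (Polynomial S) K = j.comp (algebraMap (Polynomial S) S[T;T⁻¹]) from
      RingHom.ext fun x => (hj x).symm]
  obtain ⟨y, hy⟩ := IsIntegrallyClosed.isIntegral_iff.1 h1
  exact ⟨y, hjinj ((hj y).trans hy)⟩

open scoped LaurentPolynomial in
theorem exists_toLaurent_eq_of_isIntegralElem {S S' : Type*} [CommRing S] [IsDomain S]
    [UniqueFactorizationMonoid S] [CommRing S'] {f : S' →+* S[T;T⁻¹]}
    (hf : ∀ x, ∃ p, Polynomial.toLaurent p = f x) {z : S[T;T⁻¹]} (hz : f.IsIntegralElem z) :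
    ∃ p, Polynomial.toLaurent p = z := by
  obtain ⟨p, hp, hpz⟩ := hz
  have hl : p.map f ∈ Polynomial.lifts (algebraMap (Polynomial S) S[T;T⁻¹]) := by
    rw [Polynomial.lifts_iff_coeff_lifts]
    intro i
    rw [Polynomial.coeff_map]
    exact hf _
  obtain ⟨P, hP, -, hPm⟩ := Polynomial.lifts_and_natDegree_eq_and_monic hl (hp.map f)
  refine exists_toLaurent_eq_of_isIntegral ⟨P, hPm, ?_⟩
  rwa [← Polynomial.eval_map, hP, Polynomial.eval_map]

open scoped LaurentPolynomial in
theorem exists_toLaurent_eq_neg {S : Type*} [CommRing S] {f : S →+* S[T;T⁻¹]} {x : S}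
    {p : Polynomial S} (hp : Polynomial.toLaurent p = f x) :
    ∃ p, Polynomial.toLaurent p = f (-x) :=
  ⟨-p, by rw [map_neg, map_neg, hp]⟩

open scoped LaurentPolynomial in
theorem neg_eq_C_neg_mul_T {S : Type*} [CommRing S] {f : S →+* S[T;T⁻¹]} {x : S} {i : ℤ}
    (hx : f x = LaurentPolynomial.C x * LaurentPolynomial.T i) :
    f (-x) = LaurentPolynomial.C (-x) * LaurentPolynomial.T i := by
  rw [map_neg, map_neg, hx, neg_mul]

open scoped LaurentPolynomial in
theorem coeff_sum_C_mul_T {S : Type*} [CommRing S] (f : ℤ →₀ S) (j : ℤ) :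
    (∑ i ∈ f.support, LaurentPolynomial.C (f i) * LaurentPolynomial.T i : S[T;T⁻¹]).coeff j
      = f j := by
  simp only [← LaurentPolynomial.single_eq_C_mul_T]
  simp [Finsupp.single_apply, -LaurentPolynomial.single_eq_C_mul_T, eq_comm]

end FractionEmbedding

section Weights

open scoped LaurentPolynomial
open LaurentPolynomial (T T_add T_pow T_zero)

variable {k : Type*} [Field k] {s : ℕ} (a : Fin s → ℕ)

/-- The homomorphism of `k[x₀, x₁][e₁, …, e_s]` to its Laurent polynomials in `T` that multiplies
`x_i` with `T` and `e_t` with `T ^ (-a_t)`: an element of degree `i` is multiplied with `T ^ i`. -/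
noncomputable def weightHom :
    MvPolynomial (Fin s) (Poly2 k) →+* (MvPolynomial (Fin s) (Poly2 k))[T;T⁻¹] :=
  eval₂Hom
    (eval₂Hom
      ((LaurentPolynomial.C (R := MvPolynomial (Fin s) (Poly2 k))).comp
        ((MvPolynomial.C (σ := Fin s)).comp (MvPolynomial.C (R := k) (σ := Fin 2))))
      fun i => LaurentPolynomial.C (MvPolynomial.C (MvPolynomial.X i)) * T 1)
    fun t => LaurentPolynomial.C (MvPolynomial.X t) * T (-(a t : ℤ))

theorem weightHom_C {i : ℤ} {p : Poly2 k} (hp : p ∈ polyDeg k i) :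
    weightHom a (MvPolynomial.C p) = LaurentPolynomial.C (MvPolynomial.C p) * T i := by
  rcases lt_or_ge i 0 with hi | hi
  · rw [eq_zero_of_mem_polyDeg_neg hi hp]
    simp
  lift i to ℕ using hi
  obtain ⟨c, rfl⟩ := exists_eq_sum_monomials hp
  simp only [map_sum, Finset.sum_mul]
  refine Finset.sum_congr rfl fun j _ => ?_
  have hij : (T (i : ℤ) : (MvPolynomial (Fin s) (Poly2 k))[T;T⁻¹]) =
      T 1 ^ (j : ℕ) * T 1 ^ (i - (j : ℕ)) := by
    rw [← pow_add, T_pow, mul_one]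
    congr 1
    have := j.2
    omega
  rw [hij]
  simp only [weightHom, MvPolynomial.coe_eval₂Hom, MvPolynomial.eval₂_C, MvPolynomial.eval₂_X,
    RingHom.comp_apply,
    map_mul, map_pow]
  ring

theorem weightHom_X (t : Fin s) :
    weightHom (k := k) a (MvPolynomial.X t) =
      LaurentPolynomial.C (MvPolynomial.X t) * T (-(a t : ℤ)) := by
  simp [weightHom]

/-- The elements all of whose components have nonnegative degree: their image under `weightHom`
involves no negative power of `T`. -/
noncomputable def nonnegSubring : Subring (MvPolynomial (Fin s) (Poly2 k)) where
  carrier := {z | ∃ p, Polynomial.toLaurent p = weightHom a z}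
  zero_mem' := ⟨0, by rw [map_zero, map_zero]⟩
  one_mem' := ⟨1, by rw [map_one, map_one]⟩
  add_mem' := by
    rintro x y ⟨p, hp⟩ ⟨q, hq⟩
    exact ⟨p + q, by rw [map_add, map_add, hp, hq]⟩
  mul_mem' := by
    rintro x y ⟨p, hp⟩ ⟨q, hq⟩
    exact ⟨p * q, by rw [map_mul, map_mul, hp, hq]⟩
  neg_mem' := by
    rintro x ⟨p, hp⟩
    exact exists_toLaurent_eq_neg hp

theorem mem_nonnegSubring {z : MvPolynomial (Fin s) (Poly2 k)} {i : ℤ} (hi : 0 ≤ i)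
    (hz : weightHom a z = LaurentPolynomial.C z * T i) : z ∈ nonnegSubring a := by
  lift i to ℕ using hi
  refine ⟨Polynomial.C z * Polynomial.X ^ i, ?_⟩
  rw [hz, Polynomial.toLaurent_C_mul_X_pow]

theorem C_mem_nonnegSubring (p : Poly2 k) : MvPolynomial.C p ∈ nonnegSubring a := by
  obtain ⟨t, -, hp⟩ := exists_sum_polyComp p ∅
  rw [hp, map_sum]
  refine sum_mem fun i _ => ?_
  rcases lt_or_ge i 0 with hi | hi
  · rw [eq_zero_of_mem_polyDeg_neg hi (polyComp_mem i p), map_zero]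
    exact zero_mem _
  · exact mem_nonnegSubring a hi (weightHom_C a (polyComp_mem i p))

/-- The subring of the elements of nonnegative degree is integrally closed in the polynomial ring,
because polynomials in `T` are integrally closed in Laurent polynomials. -/
theorem mem_nonnegSubring_of_isIntegralElem {S : Type*} [CommRing S]
    {f : S →+* MvPolynomial (Fin s) (Poly2 k)} (hf : ∀ x, f x ∈ nonnegSubring a)
    {w : MvPolynomial (Fin s) (Poly2 k)} (hw : f.IsIntegralElem w) : w ∈ nonnegSubring a := by
  obtain ⟨p, hp, hpw⟩ := hw
  refine exists_toLaurent_eq_of_isIntegralElem (f := (weightHom a).comp f) hf ⟨p, hp, ?_⟩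
  rw [← Polynomial.hom_eval₂, hpw, map_zero]

variable {n m : ℕ} {A : Matrix (Fin n) (Fin m) (Poly2 k)} {a}
  {b : Module.Basis (Fin s) (Poly2 k) (Module.Dual (Poly2 k) (ModE A))}
  {g : ModF A →ₗ[Poly2 k] MvPolynomial (Fin s) (Poly2 k)}

theorem apply_eq_sum_C_mul_X (hg : ∀ t, g (b.dualBasis t) = MvPolynomial.X t) (y : ModF A) :
    g y = ∑ t, MvPolynomial.C (y (b t)) * MvPolynomial.X t := by
  conv_lhs => rw [eq_sum_dualBasis b y, map_sum]
  exact Finset.sum_congr rfl fun t _ => by rw [map_smul, hg, MvPolynomial.smul_eq_C_mul]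

theorem weightHom_of_mem_degF (hb : ∀ t, b t ∈ dualDeg (degE A) (a t))
    (hg : ∀ t, g (b.dualBasis t) = MvPolynomial.X t) {i : ℤ} {y : ModF A} (hy : y ∈ degF A i) :
    weightHom a (g y) = LaurentPolynomial.C (g y) * T i := by
  rw [apply_eq_sum_C_mul_X hg, map_sum, map_sum, Finset.sum_mul]
  refine Finset.sum_congr rfl fun t _ => ?_
  rw [map_mul, weightHom_C a ((mem_degF_iff hb).1 hy t), weightHom_X, map_mul,
    mul_mul_mul_comm, ← T_add, add_neg_cancel_right]

/-- On elements of degree `i` of the polynomial ring `R(F)`, the map `weightHom` is multiplication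
by `T ^ i`. -/
theorem weightHom_of_mem_bidegPart (hb : ∀ t, b t ∈ dualDeg (degE A) (a t))
    (hg : ∀ t, g (b.dualBasis t) = MvPolynomial.X t) {i : ℤ} {j : ℕ}
    {z : MvPolynomial (Fin s) (Poly2 k)} (hz : z ∈ bidegPart g (degF A) i j) :
    weightHom a z = LaurentPolynomial.C z * T i := by
  induction hz using AddSubgroup.closure_induction with
  | mem z hz =>
    obtain ⟨d, p, c, y, hp, hy, rfl, rfl⟩ := hz
    have h1 : ∏ l, (T (c l) : (MvPolynomial (Fin s) (Poly2 k))[T;T⁻¹]) = T (∑ l, c l) := by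
      induction (Finset.univ : Finset (Fin j)) using Finset.induction_on with
      | empty => simp
      | insert l u hl ih => rw [Finset.prod_insert hl, Finset.sum_insert hl, ih, T_add]
    rw [MvPolynomial.smul_eq_C_mul, map_mul, weightHom_C a hp, map_prod,
      Finset.prod_congr rfl fun l _ => weightHom_of_mem_degF hb hg (hy l),
      Finset.prod_mul_distrib, h1, map_mul, map_prod, T_add]
    ring
  | zero => simp
  | add x y _ _ hx hy => rw [map_add, hx, hy, map_add, add_mul]
  | neg x _ hx => exact neg_eq_C_neg_mul_T hx

theorem mem_nonnegSubring_of_mem_subM (hb : ∀ t, b t ∈ dualDeg (degE A) (a t))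
    (hg : ∀ t, g (b.dualBasis t) = MvPolynomial.X t) {y : ModF A} (hy : y ∈ subM A) :
    g y ∈ nonnegSubring a := by
  induction hy using Submodule.span_induction with
  | mem y hy =>
    obtain ⟨i, hi, hy⟩ := hy
    exact mem_nonnegSubring a hi (weightHom_of_mem_degF hb hg hy)
  | zero => rw [map_zero]; exact zero_mem _
  | add x y _ _ hx hy => rw [map_add]; exact add_mem hx hy
  | smul r y _ hy =>
    rw [map_smul, MvPolynomial.smul_eq_C_mul]
    exact mul_mem (C_mem_nonnegSubring a r) hy

/-- The component of degree `i` of the polynomial ring `R(F)`. -/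
noncomputable def weightPart (g : ModF A →ₗ[Poly2 k] MvPolynomial (Fin s) (Poly2 k)) (i : ℤ) :
    Submodule ℤ (MvPolynomial (Fin s) (Poly2 k)) :=
  (⨆ j, bidegPart g (degF A) i j).toIntSubmodule

theorem bidegPart_le_weightPart (i : ℤ) (j : ℕ) {z : MvPolynomial (Fin s) (Poly2 k)}
    (hz : z ∈ bidegPart g (degF A) i j) : z ∈ weightPart g i :=
  (le_iSup (fun j => bidegPart g (degF A) i j) j) hz

theorem iSup_weightPart (hb : ∀ t, b t ∈ dualDeg (degE A) (a t))
    (hg : ∀ t, g (b.dualBasis t) = MvPolynomial.X t) : ⨆ i, weightPart g i = ⊤ := by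
  rw [eq_top_iff]
  rintro z -
  induction z using MvPolynomial.induction_on with
  | C p =>
    obtain ⟨u, -, hp⟩ := exists_sum_polyComp p ∅
    rw [hp, map_sum]
    refine sum_mem fun i _ => Submodule.mem_iSup_of_mem i ?_
    exact bidegPart_le_weightPart i 0 (algebraMap_mem_bidegPart (polyComp_mem i p))
  | add p q hp hq => exact add_mem hp hq
  | mul_X p t hp =>
    have ht : b.dualBasis t ∈ degF A (-(a t : ℤ)) := by
      have := smul_dualBasis_mem_degF hb (i := -(a t : ℤ)) (p := 1) (t := t)
        (by simpa using C_mem_polyDeg (1 : k))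
      rwa [one_smul] at this
    induction hp using Submodule.iSup_induction' with
    | mem i x hx =>
      induction hx using AddSubgroup.iSup_induction' with
      | hp j x hx =>
        rw [← hg]
        exact Submodule.mem_iSup_of_mem _ (bidegPart_le_weightPart _ _ (mul_mem_bidegPart hx ht))
      | h1 => rw [zero_mul]; exact zero_mem _
      | hadd x y _ _ hx hy => rw [add_mul]; exact add_mem hx hy
    | zero => rw [zero_mul]; exact zero_mem _
    | add x y _ _ hx hy => rw [add_mul]; exact add_mem hx hy

/-- The elements of nonnegative degree belong to the subring generated by `R` and `M`. -/
theorem nonnegSubring_le (hb : ∀ t, b t ∈ dualDeg (degE A) (a t))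
    (hg : ∀ t, g (b.dualBasis t) = MvPolynomial.X t)
    {V : Subring (MvPolynomial (Fin s) (Poly2 k))} (hC : ∀ p, MvPolynomial.C p ∈ V)
    (hV : ∀ y ∈ subM A, g y ∈ V) : nonnegSubring a ≤ V := by
  rintro z ⟨p, hp⟩
  obtain ⟨f, hf, hfz⟩ := (Submodule.mem_iSup_iff_exists_finsupp _ z).1
    (show z ∈ ⨆ i, weightPart g i by rw [iSup_weightPart hb hg]; trivial)
  have hw : ∀ i, ∀ x ∈ weightPart g i, weightHom a x = LaurentPolynomial.C x * T i := by
    intro i x hx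
    induction hx using AddSubgroup.iSup_induction' with
    | hp j x hx => exact weightHom_of_mem_bidegPart hb hg hx
    | h1 => simp
    | hadd x y _ _ hx hy => rw [map_add, hx, hy, map_add, add_mul]
  have hneg : ∀ i < 0, f i = 0 := by
    intro i hi
    have h1 : (weightHom a z).coeff i = f i := by
      rw [← hfz, Finsupp.sum, map_sum, Finset.sum_congr rfl fun i _ => hw i (f i) (hf i)]
      exact coeff_sum_C_mul_T f i
    rw [← h1, ← hp]
    change (Polynomial.toLaurent p).coeff i = 0
    rw [LaurentPolynomial.coeff_toLaurent]
    refine Finsupp.mapDomain_of_notMem_range _ _ ?_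
    rintro ⟨j, rfl⟩
    exact absurd hi (by simp)
  rw [← hfz]
  refine sum_mem fun i _ => ?_
  change f i ∈ V
  rcases lt_or_ge i 0 with hi | hi
  · rw [hneg i hi]
    exact zero_mem _
  lift i to ℕ using hi
  have hfi := hf i
  generalize f i = y at hfi
  induction hfi using AddSubgroup.iSup_induction' with
  | hp j x hx =>
    have hx' := bidegPart_degF_le_degM hb i j hx
    clear hx
    induction hx' using AddSubgroup.closure_induction with
    | mem z hz =>
      obtain ⟨d, p, c, y, -, -, -, rfl⟩ := hz
      rw [MvPolynomial.smul_eq_C_mul]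
      exact mul_mem (hC p) (prod_mem fun l _ => hV _ (y l).2)
    | zero => exact zero_mem _
    | add _ _ _ _ h h' => exact add_mem h h'
    | neg _ _ h => exact neg_mem h
  | h1 => exact zero_mem _
  | hadd x y _ _ hx hy => exact add_mem hx hy

end Weights

/-! ### The Rees algebras of `E`, `M` and `F` -/

section ReesFractions

variable {R : Type*} [CommRing R] {N P : Type*} [AddCommGroup N] [Module R N] [AddCommGroup P]
  [Module R P]

theorem rees_induction {motive : Rees R N → Prop} (algebraMap : ∀ r, motive (algebraMap R _ r))
    (ι : ∀ y, motive (reesι R N y)) (add : ∀ x y, motive x → motive y → motive (x + y))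
    (mul : ∀ x y, motive x → motive y → motive (x * y)) (z : Rees R N) : motive z := by
  have hz : z ∈ Algebra.adjoin R (Set.range (reesι R N)) := by
    rw [adjoin_range_reesι]; exact Algebra.mem_top
  induction hz using Algebra.adjoin_induction with
  | mem z hz =>
    obtain ⟨y, rfl⟩ := hz
    exact ι y
  | algebraMap r => exact algebraMap r
  | add x y _ _ hx hy => exact add x y hx hy
  | mul x y _ _ hx hy => exact mul x y hx hy

theorem smul_mul_smul_eq_map_mul {B C : Type*} [CommRing B] [Algebra R B] [CommRing C]
    [Algebra R C] (f : B →ₐ[R] C) {d d' : R} {x x' : C} {e e' : B} (h : d • x = f e)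
    (h' : d' • x' = f e') : (d * d') • (x * x') = f (e * e') := by
  rw [map_mul, ← h, ← h', smul_mul_smul_comm]

theorem mul_smul_add_eq_map_add {B C : Type*} [CommRing B] [Algebra R B] [CommRing C]
    [Algebra R C] (f : B →ₐ[R] C) {d d' : R} {x x' : C} {e e' : B} (h : d • x = f e)
    (h' : d' • x' = f e') : (d * d') • (x + x') = f (d' • e + d • e') := by
  rw [map_add, map_smul, map_smul, ← h, ← h', smul_add, mul_comm, mul_smul, mul_comm, mul_smul]

/-- The Rees algebra of `P` consists of fractions of that of `N`. -/
theorem exists_smul_eq_reesMap {r : R} (hr : r ∈ nonZeroDivisors R) {f : N →ₗ[R] P}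
    {μ : P →ₗ[R] N} (hμ : ∀ y, f (μ y) = r • y) (x : Rees R P) :
    ∃ d ∈ nonZeroDivisors R, ∃ e, d • x = reesMap f e := by
  induction x using rees_induction with
  | algebraMap t => exact ⟨1, one_mem _, algebraMap R _ t, by rw [one_smul, AlgHom.commutes]⟩
  | ι y => exact ⟨r, hr, reesι R N (μ y), by rw [reesMap_reesι, hμ, map_smul]⟩
  | add x y hx hy =>
    obtain ⟨d, hd, e, he⟩ := hx
    obtain ⟨d', hd', e', he'⟩ := hy
    exact ⟨d * d', mul_mem hd hd', _, mul_smul_add_eq_map_add (reesMap f) he he'⟩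
  | mul x y hx hy =>
    obtain ⟨d, hd, e, he⟩ := hx
    obtain ⟨d', hd', e', he'⟩ := hy
    exact ⟨d * d', mul_mem hd hd', _, smul_mul_smul_eq_map_mul (reesMap f) he he'⟩

theorem exists_mul_eq_reesMap [Nontrivial (Rees R N)] {r : R} (hr : r ∈ nonZeroDivisors R)
    {f : N →ₗ[R] P} {μ : P →ₗ[R] N} (hμ : ∀ y, f (μ y) = r • y) (x : Rees R P) :
    ∃ d e, d ≠ 0 ∧ reesMap f d * x = reesMap f e := by
  obtain ⟨d, hd, e, he⟩ := exists_smul_eq_reesMap hr hμ x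
  refine ⟨algebraMap R _ d, e, nonZeroDivisors.ne_zero (algebraMap_rees_mem_nonZeroDivisors hd), ?_⟩
  rw [AlgHom.commutes, ← he]
  exact (Algebra.smul_def d x).symm

theorem isDomain_rees [IsDomain R] {ι : Type*} (b : Module.Basis ι R N) : IsDomain (Rees R N) :=
  (reesEquivMvPolynomial b).toMulEquiv.isDomain (MvPolynomial ι R)

theorem algebraMap_rees_injective [IsDomain R] {ι : Type*} (b : Module.Basis ι R N) :
    Function.Injective (algebraMap R (Rees R N)) := by
  refine Function.Injective.of_comp (f := reesEquivMvPolynomial b) ?_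
  have h : ⇑(reesEquivMvPolynomial b) ∘ algebraMap R (Rees R N) = MvPolynomial.C :=
    funext fun r => AlgEquiv.commutes _ r
  rw [h]
  exact MvPolynomial.C_injective _ _

end ReesFractions

section IntegralClosure

variable {k : Type*} [Field k] {n m : ℕ} {A : Matrix (Fin n) (Fin m) (Poly2 k)}

theorem mulVecLin_submatrix_castLE_injective {q : ℕ} (hm : m ≤ q)
    {φ : Matrix (Fin n) (Fin q) (Poly2 k)} (hφ : Function.Injective φ.mulVecLin) :
    Function.Injective (φ.submatrix id (Fin.castLE hm)).mulVecLin := by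
  have h : LinearIndependent (Poly2 k) φ.col := Matrix.mulVec_injective_iff.1 hφ
  exact Matrix.mulVec_injective_iff.2 (h.comp _ (Fin.castLE_injective hm))

theorem toM_comp_inclM_apply {r : Poly2 k} {μ : ModF A →ₗ[Poly2 k] ModE A}
    (hμ : ∀ u, toF A (μ u) = r • u) (u : subM A) : (toM A ∘ₗ μ) (inclM A u) = r • u :=
  Subtype.ext (hμ u)

theorem toM_apply_comp_inclM {r : Poly2 k} {μ : ModF A →ₗ[Poly2 k] ModE A}
    (hμ : ∀ u, toF A (μ u) = r • u) (u : subM A) : toM A ((μ ∘ₗ inclM A) u) = r • u :=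
  Subtype.ext (hμ u)

theorem inclM_comp_toM_apply {r : Poly2 k} {μ : ModF A →ₗ[Poly2 k] ModE A}
    (hμ : ∀ e, μ (toF A e) = r • e) (e : ModE A) : (μ ∘ₗ inclM A) (toM A e) = r • e :=
  hμ e

theorem reesMF_injective {r : Poly2 k} (hr : r ∈ nonZeroDivisors (Poly2 k))
    {μ : ModF A →ₗ[Poly2 k] ModE A} (hμ : ∀ u, toF A (μ u) = r • u) :
    Function.Injective (reesMF A) :=
  reesMap_injective (N := subM A) (P := ModF A) hr (toM_comp_inclM_apply hμ)

theorem reesEM_injective {r : Poly2 k} (hr : r ∈ nonZeroDivisors (Poly2 k))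
    {μ : ModF A →ₗ[Poly2 k] ModE A} (hμ : ∀ e, μ (toF A e) = r • e) :
    Function.Injective (reesEM A) :=
  reesMap_injective (N := ModE A) (P := subM A) hr (inclM_comp_toM_apply hμ)

theorem reesEM_reesι (e : ModE A) :
    reesEM A (reesι (Poly2 k) (ModE A) e) = reesι (Poly2 k) (subM A) (toM A e) :=
  reesMap_reesι (N := ModE A) (P := subM A) _ e

theorem reesMF_reesι (y : subM A) :
    reesMF A (reesι (Poly2 k) (subM A) y) = reesι (Poly2 k) (ModF A) y :=
  reesMap_reesι (N := subM A) (P := ModF A) _ y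

variable {s : ℕ} {a : Fin s → ℕ}
  {b : Module.Basis (Fin s) (Poly2 k) (Module.Dual (Poly2 k) (ModE A))}
  {g : ModF A →ₗ[Poly2 k] MvPolynomial (Fin s) (Poly2 k)}
  {RE RM : Type*} [CommRing RE] [CommRing RM] [Algebra (Poly2 k) RE] [Algebra (Poly2 k) RM]
  {q : RE →ₐ[Poly2 k] RM} {h : RM →ₐ[Poly2 k] MvPolynomial (Fin s) (Poly2 k)}
  {ιE : ModE A → RE} {ιM : subM A → RM}

/-- If `RE ⊆ RM` are generated over `R` by the images of `E` and `M`, then `RM` is integral over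
`RE`: by Cayley--Hamilton, this holds for the elements of `M`. -/
theorem isIntegralElem_of_adjoin_eq_top (hgen : Algebra.adjoin (Poly2 k) (Set.range ιM) = ⊤)
    (hq : ∀ e, q (ιE e) = ιM (toM A e)) (hh : ∀ y : subM A, h (ιM y) = g y)
    (hinj : Function.Injective h) {c : ℕ}
    (hEF : ∀ u ∈ degF A c, ∃ v, IsHomVec c v ∧ toF A (mkE A v) = u)
    (hb : ∀ t, b t ∈ dualDeg (degE A) (a t)) (x : RM) :
    (q : RE →+* RM).IsIntegralElem x := by
  have hx : x ∈ Algebra.adjoin (Poly2 k) (Set.range ιM) := by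
    rw [hgen]; exact Algebra.mem_top
  induction hx using Algebra.adjoin_induction with
  | mem x hx =>
    obtain ⟨y, rfl⟩ := hx
    obtain ⟨p, hp, hpy⟩ := isIntegralElem_of_mem_subM (g := g)
      (MvPolynomial.C_injective _ _) hEF hb
      ((h : RM →+* MvPolynomial (Fin s) (Poly2 k)).comp (q : RE →+* RM)) ιE
      (fun e => (congrArg h (hq e)).trans (hh _)) y.2
    refine ⟨p, hp, hinj ?_⟩
    rw [← hh] at hpy
    have h1 := Polynomial.hom_eval₂ p (q : RE →+* RM) h.toRingHom (ιM y)
    exact h1.trans (hpy.trans (map_zero h).symm)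
  | algebraMap t =>
    have h1 := (q : RE →+* RM).isIntegralElem_map (x := algebraMap (Poly2 k) _ t)
    rwa [show (q : RE →+* RM) (algebraMap (Poly2 k) _ t) = _ from q.commutes t] at h1
  | add x y _ _ hx hy => exact hx.add _ hy
  | mul x y _ _ hx hy => exact hx.mul _ hy

theorem mem_nonnegSubring_of_adjoin_eq_top
    (hgen : Algebra.adjoin (Poly2 k) (Set.range ιM) = ⊤)
    (hh : ∀ y : subM A, h (ιM y) = g y) (hg : ∀ t, g (b.dualBasis t) = X t)
    (hb : ∀ t, b t ∈ dualDeg (degE A) (a t)) (x : RM) : h x ∈ nonnegSubring (k := k) a := by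
  have hx : x ∈ Algebra.adjoin (Poly2 k) (Set.range ιM) := by
    rw [hgen]; exact Algebra.mem_top
  induction hx using Algebra.adjoin_induction with
  | mem x hx =>
    obtain ⟨y, rfl⟩ := hx
    rw [hh]
    exact mem_nonnegSubring_of_mem_subM hb hg y.2
  | algebraMap t =>
    rw [AlgHom.commutes]
    exact C_mem_nonnegSubring a t
  | add x y _ _ hx hy => rw [map_add]; exact add_mem hx hy
  | mul x y _ _ hx hy => rw [map_mul]; exact mul_mem hx hy

/-- `RM` is integrally closed in the polynomial ring `R(F)`. -/
theorem mem_range_of_isIntegralElem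
    (hgen : Algebra.adjoin (Poly2 k) (Set.range ιM) = ⊤) (hh : ∀ y : subM A, h (ιM y) = g y)
    (hg : ∀ t, g (b.dualBasis t) = X t) (hb : ∀ t, b t ∈ dualDeg (degE A) (a t))
    {S : Type*} [CommRing S] {f : S →+* MvPolynomial (Fin s) (Poly2 k)} (hf : ∀ x, ∃ y, f x = h y)
    {w : MvPolynomial (Fin s) (Poly2 k)} (hw : f.IsIntegralElem w) : w ∈ h.toRingHom.range := by
  have h1 : w ∈ nonnegSubring (k := k) a := by
    refine mem_nonnegSubring_of_isIntegralElem a (fun x => ?_) hw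
    obtain ⟨y, hy⟩ := hf x
    rw [hy]
    exact mem_nonnegSubring_of_adjoin_eq_top hgen hh hg hb y
  refine nonnegSubring_le hb hg (fun p => ?_) (fun y hy => ?_) h1
  · exact ⟨algebraMap _ _ p, h.commutes p⟩
  · exact ⟨ιM ⟨y, hy⟩, hh ⟨y, hy⟩⟩

/-- The image of `RM` consists of the elements of nonnegative degree of the polynomial ring, and
`RM` is integral over `RE`; hence `RM` is the integral closure of `RE`. -/
theorem exists_integralClosure_embedding_of_adjoin_eq_top
    (hgen : Algebra.adjoin (Poly2 k) (Set.range ιM) = ⊤)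
    (hq : ∀ e, q (ιE e) = ιM (toM A e)) (hh : ∀ y : subM A, h (ιM y) = g y)
    (hg : ∀ t, g (b.dualBasis t) = X t) (hqinj : Function.Injective q)
    (hinj : Function.Injective h) (hfrac : ∀ x, ∃ d e, d ≠ 0 ∧ q d * x = q e) {c : ℕ}
    (hEF : ∀ u ∈ degF A c, ∃ v, IsHomVec c v ∧ toF A (mkE A v) = u)
    (hb : ∀ t, b t ∈ dualDeg (degE A) (a t)) :
    ∃ g : RM →+* FractionRing RE, Function.Injective g ∧
      (∀ x, g (q x) = algebraMap RE (FractionRing RE) x) ∧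
      ∀ z, IsIntegral RE z ↔ z ∈ g.range := by
  have hint := isIntegralElem_of_adjoin_eq_top hgen hq hh hinj hEF hb
  have hcl : ∀ w, (h.toRingHom.comp (q : RE →+* RM)).IsIntegralElem w → w ∈ h.toRingHom.range :=
    fun w hw => mem_range_of_isIntegralElem hgen hh hg hb (fun x => ⟨q x, rfl⟩) hw
  exact exists_integralClosure_embedding (q : RE →+* RM) h.toRingHom hqinj hinj hfrac hint hcl

theorem exists_integralClosure_reesEM {r : Poly2 k} (hr : r ∈ nonZeroDivisors (Poly2 k))
    {μ : ModF A →ₗ[Poly2 k] ModE A} (hμ : ∀ e, μ (toF A e) = r • e)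
    (hμ' : ∀ u, toF A (μ u) = r • u) {c : ℕ}
    (hEF : ∀ u ∈ degF A c, ∃ v, IsHomVec c v ∧ toF A (mkE A v) = u)
    (hb : ∀ t, b t ∈ dualDeg (degE A) (a t)) :
    ∃ g : Rees (Poly2 k) (subM A) →+* FractionRing (Rees (Poly2 k) (ModE A)),
      Function.Injective g ∧
      (∀ x, g (reesEM A x) = algebraMap _ _ x) ∧
      ∀ z, IsIntegral (Rees (Poly2 k) (ModE A)) z ↔ z ∈ g.range := by
  have hinj := (reesEquivMvPolynomial b.dualBasis).injective.comp (reesMF_injective hr hμ')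
  have hq := reesEM_injective hr hμ
  have hnt : Nontrivial (Rees (Poly2 k) (ModE A)) := by
    refine ⟨0, 1, fun h01 => ?_⟩
    have h1 := congrArg (reesEM A) h01
    rw [map_zero, map_one] at h1
    have h2 := congrArg ((reesEquivMvPolynomial b.dualBasis).toAlgHom.comp (reesMF A)) h1
    rw [map_zero, map_one] at h2
    exact zero_ne_one h2
  have hfrac := exists_mul_eq_reesMap (N := ModE A) (P := subM A) hr
    (toM_apply_comp_inclM hμ')
  exact exists_integralClosure_embedding_of_adjoin_eq_top
    (RE := Rees (Poly2 k) (ModE A)) (RM := Rees (Poly2 k) (subM A))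
    (q := reesEM A) (h := (reesEquivMvPolynomial b.dualBasis).toAlgHom.comp (reesMF A))
    (ιE := reesι (Poly2 k) (ModE A)) (ιM := reesι (Poly2 k) (subM A))
    (g := (reesEquivMvPolynomial b.dualBasis).toLinearMap ∘ₗ reesι (Poly2 k) (ModF A))
    adjoin_range_reesι (reesEM_reesι (A := A))
    (fun y => congrArg (reesEquivMvPolynomial b.dualBasis) (reesMF_reesι y))
    (fun t => reesEquivMvPolynomial_basis _ t) hq hinj hfrac hEF hb

/-- `E` is a reduction of `M`, as products of sufficiently many elements of `M` may be rewritten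
with a factor from `E`. -/
theorem isReductionIn_range_toF {c : ℕ}
    (hEF : ∀ u ∈ degF A c, ∃ v, IsHomVec c v ∧ toF A (mkE A v) = u)
    (hb : ∀ t, b t ∈ dualDeg (degE A) (a t)) :
    IsReductionIn (LinearMap.range (toF A)) (subM A) := by
  have hdom := isDomain_rees b.dualBasis
  refine ⟨?_, exists_map_subM_pow_succ_eq (B := Rees (Poly2 k) (ModF A))
    (g := reesι (Poly2 k) (ModF A)) (algebraMap_rees_injective b.dualBasis) hEF hb⟩
  rintro _ ⟨e, rfl⟩
  exact toF_mem_subM A e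

/-- Some power of each variable kills the quotient `F / E`, so that multiplication by it maps `F`
to `E`. -/
theorem exists_X_pow_smul_section {q : ℕ} (hm : m ≤ q) {f : Fin n → Poly2 k} {d : ℕ}
    (hf : ∀ i, (f i).IsHomogeneous d) (hheight : (Ideal.span (Set.range f)).height = 2)
    {φ : Matrix (Fin n) (Fin q) (Poly2 k)} (hφ_inj : Function.Injective φ.mulVecLin)
    (hφ_exact : ∀ v : Fin n → Poly2 k, v ∈ LinearMap.range φ.mulVecLin ↔ ∑ i, v i * f i = 0)
    (hA : A = φ.submatrix id (Fin.castLE hm)) :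
    ∃ (N : ℕ) (μ : Fin 2 → ModF A →ₗ[Poly2 k] ModE A),
      (∀ t u, toF A (μ t u) = (X t ^ N : Poly2 k) • u) ∧
      ∀ t e, μ t (toF A e) = (X t ^ N : Poly2 k) • e := by
  have h1 : ∀ t : Fin 2, ∃ N : ℕ, (X t ^ N : Poly2 k) ∈ Ideal.span (Set.range f) := fun t =>
    X_mem_radical_span_of_height_eq_two (by rintro _ ⟨i, rfl⟩; exact ⟨d, hf i⟩) hheight t
  choose e he using h1
  have h2 : ∀ t : Fin 2, ∃ μ : ModF A →ₗ[Poly2 k] ModE A,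
      (∀ u, toF A (μ u) = (X t ^ (e 0 + e 1) : Poly2 k) • u) ∧
      ∀ x, μ (toF A x) = (X t ^ (e 0 + e 1) : Poly2 k) • x := fun t => by
    have ht : (X t ^ (e 0 + e 1) : Poly2 k) ∈ Ideal.span (Set.range f) :=
      Ideal.pow_mem_of_pow_mem _ (he t) (by fin_cases t <;> simp)
    obtain ⟨l, x, hlx⟩ := exists_free_factorization hm hφ_inj hφ_exact hA ht
    exact exists_bidual_section _ l x hlx
  choose μ hμ' hμ using h2
  exact ⟨_, μ, hμ', hμ⟩

end IntegralClosure

end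

/-! ### Comparison of the three Rees algebras -/

set_option maxHeartbeats 400000 in
theorem mainTheorem5 {k : Type*} [Field k] (n d : ℕ)
    (f : Fin n → MvPolynomial (Fin 2) k)
    (hf : ∀ i, (f i).IsHomogeneous d)
    (hheight : (Ideal.span (Set.range f)).height = 2)
    (φ : Matrix (Fin n) (Fin (n - 1)) (MvPolynomial (Fin 2) k))
    (deg : Fin (n - 1) → ℕ)
    (hdeg_pos : ∀ j, 1 ≤ deg j)
    (hdeg_mono : Monotone deg)
    (hφ : ∀ i j, (φ i j).IsHomogeneous (deg j))
    (hφ_inj : Function.Injective φ.mulVecLin)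
    (hφ_exact : ∀ v : Fin n → MvPolynomial (Fin 2) k,
      v ∈ LinearMap.range φ.mulVecLin ↔ ∑ i, v i * f i = 0)
    (m : ℕ) (hm1 : 1 ≤ m) (hm : m ≤ n - 1)
    (A : Matrix (Fin n) (Fin m) (MvPolynomial (Fin 2) k))
    (hA : A = φ.submatrix id (Fin.castLE hm))
    (c : ℤ) (hc : c = (deg ⟨m - 1, by omega⟩ : ℤ) - 1) :
    -- the canonical maps `E → M → F` and `R(E) → R(M) → R(F)` are inclusions, and these Rees
    -- algebras are domains
    (Function.Injective (toF A) ∧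
      Function.Injective (reesEM A) ∧
      Function.Injective (reesMF A) ∧
      IsDomain (Rees (Poly2 k) (ModF A))) ∧
    -- (a)
    ((reesGE (degE A) c).map (reesEF A).toRingHom.toAddMonoidHom =
        (reesGE (degM A) c).map (reesMF A).toRingHom.toAddMonoidHom ∧
      (reesGE (degM A) c).map (reesMF A).toRingHom.toAddMonoidHom =
        reesGE (degF A) c) ∧
    -- (b)
    (∃ g : Rees (Poly2 k) (subM A) →+* FractionRing (Rees (Poly2 k) (ModE A)),
      Function.Injective g ∧
      (∀ x, g (reesEM A x) = algebraMap _ _ x) ∧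
      ∀ z, IsIntegral (Rees (Poly2 k) (ModE A)) z ↔ z ∈ g.range) ∧
    -- (c)
    IsReductionIn (LinearMap.range (toF A)) (subM A) := by
  have hAinj : Function.Injective A.mulVecLin := by
    rw [hA]
    exact mulVecLin_submatrix_castLE_injective hm hφ_inj
  have hAdeg : ∀ l j, A l j ∈ polyDeg k (deg (Fin.castLE hm j)) := fun l j => by
    rw [hA, mem_polyDeg_natCast_iff]
    exact hφ _ _
  obtain ⟨N, μ, hμ', hμ⟩ := exists_X_pow_smul_section hm hf hheight hφ_inj hφ_exact hA
  have hr : (MvPolynomial.X 0 ^ N : Poly2 k) ∈ nonZeroDivisors (Poly2 k) :=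
    mem_nonZeroDivisors_of_ne_zero (pow_ne_zero _ (MvPolynomial.X_ne_zero 0))
  obtain ⟨s, a, b, hb⟩ := exists_homogeneous_dual_basis hAdeg
  obtain ⟨c, rfl⟩ : ∃ c' : ℕ, c = c' := by
    refine Int.eq_ofNat_of_zero_le ?_
    have := hdeg_pos ⟨m - 1, by omega⟩
    omega
  have hEF : ∀ i : ℤ, c ≤ i → ∀ u ∈ degF A i, ∃ v, IsHomVec i v ∧ toF A (mkE A v) = u := by
    intro i hi u hu
    refine exists_isHomVec_toF_eq hAinj hAdeg hμ hμ' hb (fun j => ?_) hu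
    have h1 : deg (Fin.castLE hm j) ≤ deg ⟨m - 1, by omega⟩ :=
      hdeg_mono (Fin.mk_le_mk.2 (by omega))
    omega
  have hE := map_reesGE_degE (Int.natCast_nonneg c) hEF hb
  have hM := map_reesGE_degM (Int.natCast_nonneg c) hb
  exact ⟨⟨toF_injective hAinj hμ, reesEM_injective hr (hμ 0), reesMF_injective hr (hμ' 0),
      isDomain_rees b.dualBasis⟩, ⟨hE.trans hM.symm, hM⟩,
    exists_integralClosure_reesEM hr (hμ 0) (hμ' 0) (hEF c le_rfl) hb,
    isReductionIn_range_toF (hEF c le_rfl) hb⟩
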